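/- Let $n\ge 1$ and let $\Omega\subset\mathbb R^n$ be open. $\mathcal H^{k}$ denotes the $k$-dimensional Hausdorff measure, $\mathbb S^{n-1}$ the unit sphere and, for $\xi\in\mathbb S^{n-1}$, $\Pi^\xi=\{y\in\mathbb R^n: y\cdot\xi=0\}$. For $E\subset\mathbb R^n$ and $x\in\mathbb R^n$ put $E^\xi_x=\{t\in\mathbb R: x+t\xi\in E\}$, and for $u:\Omega\to\mathbb R^n$ put $\hat u^\xi_x(t)=u(x+t\xi)\cdot\xi$, $t\in\Omega^\xi_x$. For $A\subset\mathbb R$ open and $v:A\to\mathbb R$, the jump set $J_v$ is the set of $t\in A$ at which the one-sided approximate limits $v^-(t),v^+(t)\in\mathbb R$ exist and are different, where $v^{+}(t)=a$ means that $\lim_{r\to0^+} r^{-1}\mathcal L^1(\{s\in(t,t+r)\cap A: |v(s)-a|>\varepsilon\})=0$ for every $\varepsilon>0$, and similarly for $v^-(t)$ with $(t-r,t)$; moreover $J^1_v=\{t\in J_v: |v^+(t)-v^-(t)|>1\}$. The space $\mathrm{GBV}^{\mathcal E}(\Omega;\mathbb R^n)$ consists of the $\mathcal L^n$-measurable functions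 $u:\Omega\to\mathbb R^n$ such that $\hat u^\xi_y\in BV_{loc}(\Omega^\xi_y)$ for $\mathcal H^{n-1}$-a.e. $\xi\in\mathbb S^{n-1}$ and $\mathcal H^{n-1}$-a.e. $y\in\Pi^\xi$, and such that for some finite positive Borel measure $\lambda$ on $\Omega$ and every open $U\subset\Omega$ $$\int_{\mathbb S^{n-1}}\int_{\Pi^\xi}\Big(|D\hat u^\xi_y|(U^\xi_y\setminus J^1_{\hat u^\xi_y})+\mathcal H^0(U^\xi_y\cap J^1_{\hat u^\xi_y})\Big)\,d\mathcal H^{n-1}(y)\,d\mathcal H^{n-1}(\xi)\le\lambda(U).$$ For $\xi\in\mathbb S^{n-1}$ and $U\subset\Omega$ open let $\mu^\xi_u(U)$ be the inner integral (over $\Pi^\xi$) above if $\hat u^\xi_y\in BV_{loc}(U^\xi_y)$ for $\mathcal H^{n-1}$-a.e. $y\in\Pi^\xi$, and $\mu^\xi_u(U)=\infty$ otherwise. For $U\subset\Omega$ open let $$\hat\mu^1_u(U)=\sup_{\mathscr B}\sum_{B\in\mathscr B}\int_{\mathbb S^{n-1}}\mu^\xi_u(B)\,d\mathcal H^{n-1}(\xi),$$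 where $\mathscr B$ ranges over the finite families of pairwise disjoint open balls contained in $U$, and for arbitrary $B\subset\Omega$ let $\hat\mu^1_u(B)=\inf\{\hat\mu^1_u(U): B\subset U\subset\Omega,\ U\text{ open}\}$. For $x\in\Omega$ let $$\Theta^{*n-1}(\hat\mu^1_u,x)=\limsup_{r\to0^+}\frac{\hat\mu^1_u(\overline B_r(x))}{\alpha(n-1)\,r^{n-1}},$$ where $\alpha(n-1)$ is the volume of the unit ball of $\mathbb R^{n-1}$ (with $\alpha(0)=1$). **Proposition.** Let $u\in\mathrm{GBV}^{\mathcal E}(\Omega;\mathbb R^n)$. Then for $\hat\mu^1_u$-a.e. $x\in\Omega$ the following holds: if $\Theta^{*n-1}(\hat\mu^1_u,x)=0$, then the set $\{\xi\in\mathbb S^{n-1}: 0\in J_{\hat u^\xi_x}\}$ is $\mathcal H^{n-1}$-negligible. -/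

import Mathlib

open Set Filter Topology MeasureTheory
open scoped ENNReal

noncomputable section

namespace GBVE

/-! ### Functions of one real variable on an open set `A`

A function `v : A → ℝ` is represented by a total function `v : ℝ → ℝ`; every notion below
only looks at the values of `v` on `A` (or on the open set `V ⊆ A` in question). -/

/-- The total variation `|Dv|(V)` of the distributional derivative of `v` on the open set `V`:
the supremum of `∫ v φ'` over `φ ∈ C¹_c(V)` with `|φ| ≤ 1`. -/
def variationOpen (v : ℝ → ℝ) (V : Set ℝ) : ℝ≥0∞ :=
  ⨆ (φ : ℝ → ℝ) (_ : ContDiff ℝ 1 φ) (_ : HasCompactSupport φ) (_ : tsupport φ ⊆ V)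
    (_ : ∀ t, |φ t| ≤ 1), ENNReal.ofReal (∫ t, v t * deriv φ t)

/-- The total variation measure `|Dv|(B)` of an arbitrary `B ⊆ A`, where `v` is a function on the
open set `A`: the outer regular extension of `|Dv|` from open sets. -/
def variation (A : Set ℝ) (v : ℝ → ℝ) (B : Set ℝ) : ℝ≥0∞ :=
  ⨅ (V : Set ℝ) (_ : IsOpen V) (_ : B ⊆ V) (_ : V ⊆ A), variationOpen v V

/-- `v ∈ BV_loc(A)` for `A ⊆ ℝ` open: `v ∈ L¹_loc(A)` and `|Dv|(V) < ∞` for every open `V`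
compactly contained in `A`. -/
def IsBVLoc (A : Set ℝ) (v : ℝ → ℝ) : Prop :=
  LocallyIntegrableOn v A volume ∧
    ∀ V : Set ℝ, IsOpen V → IsCompact (closure V) → closure V ⊆ A → variationOpen v V < ∞

/-- `a` is the right approximate limit `v⁺(t)` of `v : A → ℝ` at `t`. -/
def IsRightApproxLimit (A : Set ℝ) (v : ℝ → ℝ) (t a : ℝ) : Prop :=
  ∀ ε : ℝ, 0 < ε →
    Tendsto (fun r : ℝ => volume {s | s ∈ Ioo t (t + r) ∩ A ∧ ε < |v s - a|} / ENNReal.ofReal r)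
      (𝓝[>] 0) (𝓝 0)

/-- `a` is the left approximate limit `v⁻(t)` of `v : A → ℝ` at `t`. -/
def IsLeftApproxLimit (A : Set ℝ) (v : ℝ → ℝ) (t a : ℝ) : Prop :=
  ∀ ε : ℝ, 0 < ε →
    Tendsto (fun r : ℝ => volume {s | s ∈ Ioo (t - r) t ∩ A ∧ ε < |v s - a|} / ENNReal.ofReal r)
      (𝓝[>] 0) (𝓝 0)

/-- The (approximate) jump set `J_v` of `v : A → ℝ`. -/
def jumpSet (A : Set ℝ) (v : ℝ → ℝ) : Set ℝ :=
  {t | t ∈ A ∧ ∃ a b : ℝ, IsLeftApproxLimit A v t a ∧ IsRightApproxLimit A v t b ∧ a ≠ b}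

/-- `J¹_v`: the points of `J_v` where the jump `|v⁺ - v⁻|` is larger than `1`. -/
def jumpSetOne (A : Set ℝ) (v : ℝ → ℝ) : Set ℝ :=
  {t | t ∈ A ∧ ∃ a b : ℝ, IsLeftApproxLimit A v t a ∧ IsRightApproxLimit A v t b ∧ 1 < |b - a|}

/-! ### Slices -/

variable {n : ℕ}

/-- The unit sphere `S^{n-1}`. -/
abbrev unitSphere (n : ℕ) : Set (EuclideanSpace ℝ (Fin n)) := Metric.sphere 0 1

/-- The hyperplane `Π^ξ` through the origin orthogonal to `ξ`. -/
abbrev hyperplane (ξ : EuclideanSpace ℝ (Fin n)) : Set (EuclideanSpace ℝ (Fin n)) :=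
  {y | inner ℝ y ξ = 0}

/-- `E^ξ_x = {t : x + t ξ ∈ E}`. -/
def sliceSet (E : Set (EuclideanSpace ℝ (Fin n))) (ξ x : EuclideanSpace ℝ (Fin n)) : Set ℝ :=
  {t | x + t • ξ ∈ E}

/-- `û^ξ_x(t) = u(x + t ξ) · ξ`. -/
def slice (u : EuclideanSpace ℝ (Fin n) → EuclideanSpace ℝ (Fin n))
    (ξ x : EuclideanSpace ℝ (Fin n)) : ℝ → ℝ :=
  fun t => inner ℝ (u (x + t • ξ)) ξ

/-- `|Dû^ξ_y|(U^ξ_y ∖ J¹) + H⁰(U^ξ_y ∩ J¹)`, where `J¹ = J¹_{û^ξ_y}` and `û^ξ_y` is a function on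
`Ω^ξ_y`. -/
def sliceEnergy (Ω : Set (EuclideanSpace ℝ (Fin n)))
    (u : EuclideanSpace ℝ (Fin n) → EuclideanSpace ℝ (Fin n))
    (ξ y : EuclideanSpace ℝ (Fin n)) (U : Set (EuclideanSpace ℝ (Fin n))) : ℝ≥0∞ :=
  variation (sliceSet Ω ξ y) (slice u ξ y)
      (sliceSet U ξ y \ jumpSetOne (sliceSet Ω ξ y) (slice u ξ y)) +
    ((sliceSet U ξ y ∩ jumpSetOne (sliceSet Ω ξ y) (slice u ξ y)).encard : ℝ≥0∞)

/-- The space `GBV^E(Ω; ℝⁿ)`. -/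
def MemGBVE (Ω : Set (EuclideanSpace ℝ (Fin n)))
    (u : EuclideanSpace ℝ (Fin n) → EuclideanSpace ℝ (Fin n)) : Prop :=
  AEMeasurable u (volume.restrict Ω) ∧
  (∀ᵐ ξ ∂(μHE[n - 1].restrict (unitSphere n)), ∀ᵐ y ∂(μHE[n - 1].restrict (hyperplane ξ)),
    IsBVLoc (sliceSet Ω ξ y) (slice u ξ y)) ∧
  ∃ lam : Measure (EuclideanSpace ℝ (Fin n)), IsFiniteMeasure lam ∧
    ∀ U : Set (EuclideanSpace ℝ (Fin n)), IsOpen U → U ⊆ Ω →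
      ∫⁻ ξ in unitSphere n, (∫⁻ y in hyperplane ξ, sliceEnergy Ω u ξ y U ∂μHE[n - 1])
        ∂μHE[n - 1] ≤ lam U

open Classical in
/-- `μ^ξ_u(U)` for open `U ⊆ Ω`: the integral of the slice energies over `Π^ξ` if almost every slice
is in `BV_loc(U^ξ_y)`, and `∞` otherwise. -/
def muDirOpen (Ω : Set (EuclideanSpace ℝ (Fin n)))
    (u : EuclideanSpace ℝ (Fin n) → EuclideanSpace ℝ (Fin n))
    (ξ : EuclideanSpace ℝ (Fin n)) (U : Set (EuclideanSpace ℝ (Fin n))) : ℝ≥0∞ :=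
  if ∀ᵐ y ∂(μHE[n - 1].restrict (hyperplane ξ)), IsBVLoc (sliceSet U ξ y) (slice u ξ y) then
    ∫⁻ y in hyperplane ξ, sliceEnergy Ω u ξ y U ∂μHE[n - 1]
  else ∞

/-- The measure `μ^ξ_u` of `B ⊆ Ω`: the outer regular extension from open sets. -/
def muDir (Ω : Set (EuclideanSpace ℝ (Fin n)))
    (u : EuclideanSpace ℝ (Fin n) → EuclideanSpace ℝ (Fin n))
    (ξ : EuclideanSpace ℝ (Fin n)) (B : Set (EuclideanSpace ℝ (Fin n))) : ℝ≥0∞ :=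
  ⨅ (U : Set (EuclideanSpace ℝ (Fin n))) (_ : IsOpen U) (_ : B ⊆ U) (_ : U ⊆ Ω),
    muDirOpen Ω u ξ U

/-- `𝓑` is a finite family of pairwise disjoint open balls contained in `U`. -/
def IsBallFamily (U : Set (EuclideanSpace ℝ (Fin n)))
    (𝓑 : Finset (Set (EuclideanSpace ℝ (Fin n)))) : Prop :=
  (∀ B ∈ 𝓑, ∃ (c : EuclideanSpace ℝ (Fin n)) (r : ℝ), 0 < r ∧ B = Metric.ball c r) ∧
  (∀ B ∈ 𝓑, B ⊆ U) ∧
  (𝓑 : Set (Set (EuclideanSpace ℝ (Fin n)))).PairwiseDisjoint id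

/-- `μ̂^p_u(U)` for open `U ⊆ Ω`: the supremum of `∑_B (∫_{S^{n-1}} μ^ξ_u(B)^p dH^{n-1}(ξ))^{1/p}`
over the finite families of pairwise disjoint open balls contained in `U`. -/
def muHatOpen (Ω : Set (EuclideanSpace ℝ (Fin n)))
    (u : EuclideanSpace ℝ (Fin n) → EuclideanSpace ℝ (Fin n)) (p : ℝ)
    (U : Set (EuclideanSpace ℝ (Fin n))) : ℝ≥0∞ :=
  ⨆ (𝓑 : Finset (Set (EuclideanSpace ℝ (Fin n)))) (_ : IsBallFamily U 𝓑),
    ∑ B ∈ 𝓑, (∫⁻ ξ in unitSphere n, (muDir Ω u ξ B) ^ p ∂μHE[n - 1]) ^ (1 / p)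

/-- The measure `μ̂^p_u` of `B ⊆ Ω`: the outer regular extension from open sets. -/
def muHat (Ω : Set (EuclideanSpace ℝ (Fin n)))
    (u : EuclideanSpace ℝ (Fin n) → EuclideanSpace ℝ (Fin n)) (p : ℝ)
    (B : Set (EuclideanSpace ℝ (Fin n))) : ℝ≥0∞ :=
  ⨅ (U : Set (EuclideanSpace ℝ (Fin n))) (_ : IsOpen U) (_ : B ⊆ U) (_ : U ⊆ Ω),
    muHatOpen Ω u p U

/-- The upper `m`-density `Θ^{*m}(μ, x) = limsup_{r → 0⁺} μ(B̄(x, r)) / (α(m) r^m)`, where `α(m)` is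
the volume of the unit ball of `ℝᵐ`. The set function `μ` is given on the subsets of an open set
that contains `x`; only small balls matter. -/
def upperDensity (m : ℕ) (μ : Set (EuclideanSpace ℝ (Fin n)) → ℝ≥0∞)
    (x : EuclideanSpace ℝ (Fin n)) : ℝ≥0∞ :=
  limsup (fun r : ℝ => μ (Metric.closedBall x r) /
    (volume (Metric.ball (0 : EuclideanSpace ℝ (Fin m)) 1) * ENNReal.ofReal (r ^ m))) (𝓝[>] 0)

end GBVE

end

open Set Filter Topology MeasureTheory
open scoped ENNReal

noncomputable section

namespace GBVE

variable {n : ℕ}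

/-! The conclusion holds at every `x` of `Ω` with vanishing density, so the exceptional set is
empty. The point is to pass from information on almost every line to the lines through one
prescribed point `x`.

Along a line, if the slice energy in a ball is below `ε ≤ 1`, there is no large jump and the
essential oscillation is at most `ε` (`exists_null_abs_sub_le`). Hence pairs `(p, q)` in the ball
whose difference `g p - g q` has component larger than `ε` along `p - q`, where `g` is a Borel
representative of `u`, lie essentially on lines of energy at least `ε`. A Markov estimate on each
line, integrated over lines and directions, bounds their measure by a constant times `R ^ (n + 1) /
ε` times `muHat` of the closed ball (`volume_badPairs_le`). At a point of vanishing density this is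
`o(R ^ (2 n))`.

Antipodal pairs `x ± z` form a null family among all pairs, so this says nothing about them
directly. They are completed to parallelograms with vertices `x ± z`, `x + v`, `x + 2 z + v`: by the
linear identity `inner_parallelogram`, if the antipodal pair is bad with constant `12 ε`, then for
every `v` one of the other five pairs is bad. Averaging over `v` shows that the bad `z` of size
about `r` have measure `o(r ^ n)` (`volume_badAnnulus_mul_le`, `tendsto_volume_badAnnulus`).

In polar coordinates and by Fatou's lemma, for almost every `ξ` the times `t` at which the slices at
`x ± t ξ` differ by more than `12 ε` have lower density zero along a sequence of scales. A jump at
`0` larger than `12 ε` would give them positive lower density (`not_liminf_badTimes_eq_zero`). The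
polar measure and `H^{n-1}` on the sphere are compared by `map_toSphere_le` and
`hausdorff_null_of_toSphere_null`. -/

/-! ### Functions of one variable with small variation -/

/-- The primitive of a normalized bump function that vanishes at `-∞`. -/
def bumpPrimitive (φ : ContDiffBump (0 : ℝ)) (y : ℝ) : ℝ :=
  ∫ τ in Iic y, φ.normed volume τ

lemma bump_normed_eq_zero (φ : ContDiffBump (0 : ℝ)) {y : ℝ} (hy : φ.rOut ≤ |y|) :
    φ.normed volume y = 0 := by
  have : y ∉ Function.support (φ.normed volume) := by
    rw [φ.support_normed_eq]
    simpa using hy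
  simpa using this

lemma bumpPrimitive_of_le (φ : ContDiffBump (0 : ℝ)) {y : ℝ} (hy : y ≤ -φ.rOut) :
    bumpPrimitive φ y = 0 := by
  refine setIntegral_eq_zero_of_forall_eq_zero fun τ hτ => bump_normed_eq_zero φ ?_
  have h1 : τ ≤ y := hτ
  have h2 := neg_le_abs τ
  linarith

lemma bumpPrimitive_of_ge (φ : ContDiffBump (0 : ℝ)) {y : ℝ} (hy : φ.rOut ≤ y) :
    bumpPrimitive φ y = 1 := by
  have h : ∫ τ in Ioi y, φ.normed volume τ = 0 := by
    refine setIntegral_eq_zero_of_forall_eq_zero fun τ hτ => bump_normed_eq_zero φ ?_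
    have h1 : y < τ := hτ
    have h2 := le_abs_self τ
    linarith
  have := integral_add_compl (measurableSet_Iic (a := y)) (φ.integrable_normed (μ := volume))
  rw [compl_Iic, h, φ.integral_normed, add_zero] at this
  exact this

lemma bumpPrimitive_nonneg (φ : ContDiffBump (0 : ℝ)) (y : ℝ) : 0 ≤ bumpPrimitive φ y :=
  integral_nonneg fun τ => φ.nonneg_normed τ

lemma bumpPrimitive_le_one (φ : ContDiffBump (0 : ℝ)) (y : ℝ) : bumpPrimitive φ y ≤ 1 := by
  rw [← φ.integral_normed (μ := (volume : Measure ℝ))]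
  exact setIntegral_le_integral φ.integrable_normed (Eventually.of_forall fun τ => φ.nonneg_normed τ)

lemma hasDerivAt_bumpPrimitive (φ : ContDiffBump (0 : ℝ)) (y : ℝ) :
    HasDerivAt (bumpPrimitive φ) (φ.normed volume y) y := by
  have h1 : bumpPrimitive φ = fun y => bumpPrimitive φ 0 + ∫ τ in (0 : ℝ)..y, φ.normed volume τ := by
    funext y
    rw [← intervalIntegral.integral_Iic_sub_Iic φ.integrable_normed.integrableOn
      φ.integrable_normed.integrableOn]
    simp [bumpPrimitive]
  rw [h1]
  exact ((φ.continuous_normed).integral_hasStrictDerivAt 0 y).hasDerivAt.const_add _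

/-- Testing the distributional derivative with a smoothed indicator function of `[s, t]`. -/
lemma abs_convolution_sub_le {v : ℝ → ℝ} {I : Set ℝ} {ε : ℝ} (hε : 0 ≤ ε)
    (h : variationOpen v I ≤ ENNReal.ofReal ε) {a b s t : ℝ} (hab : Icc a b ⊆ I)
    (hv : IntegrableOn v (Icc a b)) (hst : s ≤ t) (φ : ContDiffBump (0 : ℝ))
    (hs : a ≤ s - φ.rOut) (ht : t + φ.rOut ≤ b) :
    |(∫ y, φ.normed volume (s - y) • (Icc a b).indicator v y) -
      ∫ y, φ.normed volume (t - y) • (Icc a b).indicator v y| ≤ ε := by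
  set θ : ℝ → ℝ := fun y => bumpPrimitive φ (y - s) - bumpPrimitive φ (y - t) with hθ
  set θ' : ℝ → ℝ := fun y => φ.normed volume (s - y) - φ.normed volume (t - y) with hθ'
  have hr := φ.rOut_pos
  have hderiv : ∀ y, HasDerivAt θ (θ' y) y := by
    intro y
    have h1 := (hasDerivAt_bumpPrimitive φ (y - s)).comp_sub_const y s
    have h2 := (hasDerivAt_bumpPrimitive φ (y - t)).comp_sub_const y t
    have h3 := h1.sub h2
    -- The bump is even; with the arguments reversed, the derivative is a difference of convolution
    -- kernels at `s` and `t`.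
    rw [← neg_sub s y, ← neg_sub t y, φ.normed_neg, φ.normed_neg] at h3
    exact h3
  have hcont : Continuous θ' :=
    (φ.continuous_normed.comp (continuous_const.sub continuous_id)).sub
      (φ.continuous_normed.comp (continuous_const.sub continuous_id))
  have hderiv' : deriv θ = θ' := funext fun y => (hderiv y).deriv
  have hC1 : ContDiff ℝ 1 θ := by
    rw [contDiff_one_iff_deriv, hderiv']
    exact ⟨fun y => (hderiv y).differentiableAt, hcont⟩
  have hzero : ∀ y, y ∉ Icc (s - φ.rOut) (t + φ.rOut) → θ y = 0 := by
    intro y hy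
    rw [mem_Icc, not_and_or, not_le, not_le] at hy
    rcases hy with hy | hy
    · simp only [hθ]
      rw [bumpPrimitive_of_le φ (by linarith), bumpPrimitive_of_le φ (by linarith), sub_zero]
    · simp only [hθ]
      rw [bumpPrimitive_of_ge φ (by linarith), bumpPrimitive_of_ge φ (by linarith), sub_self]
  have hcs : HasCompactSupport θ := HasCompactSupport.intro isCompact_Icc hzero
  have hts : tsupport θ ⊆ Icc a b := by
    have h1 : tsupport θ ⊆ Icc (s - φ.rOut) (t + φ.rOut) :=
      closure_minimal (fun y hy => by_contra fun hy' => hy (hzero y hy')) isClosed_Icc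
    exact h1.trans (Icc_subset_Icc hs ht)
  have hb : ∀ y, |θ y| ≤ 1 := by
    intro y
    have h1 := bumpPrimitive_nonneg φ (y - s)
    have h2 := bumpPrimitive_nonneg φ (y - t)
    have h3 := bumpPrimitive_le_one φ (y - s)
    have h4 := bumpPrimitive_le_one φ (y - t)
    rw [abs_le]
    constructor <;> simp only [hθ] <;> linarith
  -- Truncation makes `v` integrable on the whole line and is harmless because `θ` is supported in
  -- `Icc a b`.
  have hw : Integrable ((Icc a b).indicator v) :=
    (integrable_indicator_iff measurableSet_Icc).2 hv
  have hint : ∀ c : ℝ,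
      Integrable fun y => φ.normed volume (c - y) • (Icc a b).indicator v y := by
    intro c
    have hcc : Continuous fun y => φ.normed volume (c - y) :=
      φ.continuous_normed.comp (continuous_const.sub continuous_id)
    obtain ⟨C, hC⟩ := φ.hasCompactSupport_normed.exists_bound_of_continuous
      (φ.continuous_normed (μ := (volume : Measure ℝ)))
    exact hw.bdd_mul hcc.aestronglyMeasurable (Eventually.of_forall fun y => hC (c - y))
  have heq : (∫ y, φ.normed volume (s - y) • (Icc a b).indicator v y) -
      (∫ y, φ.normed volume (t - y) • (Icc a b).indicator v y) = ∫ y, v y * deriv θ y := by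
    rw [← integral_sub (hint s) (hint t)]
    refine integral_congr_ae (Eventually.of_forall fun y => ?_)
    by_cases hy : y ∈ Icc a b
    · simp only [indicator_of_mem hy, hderiv', hθ', smul_eq_mul]
      ring
    · have h0 : deriv θ y = 0 := by
        by_contra h0
        exact hy (hts (support_deriv_subset h0))
      simp only [indicator_of_notMem hy, h0]
      simp
  have key : ∀ ψ : ℝ → ℝ, ContDiff ℝ 1 ψ → HasCompactSupport ψ → tsupport ψ ⊆ I →
      (∀ t, |ψ t| ≤ 1) → ∫ y, v y * deriv ψ y ≤ ε := by
    intro ψ h1 h2 h3 h4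
    have : ENNReal.ofReal (∫ y, v y * deriv ψ y) ≤ variationOpen v I :=
      le_iSup_of_le ψ <| le_iSup_of_le h1 <| le_iSup_of_le h2 <| le_iSup_of_le h3 <|
        le_iSup_of_le h4 le_rfl
    exact (ENNReal.ofReal_le_ofReal_iff hε).1 (this.trans h)
  rw [heq, abs_le]
  -- `ENNReal.ofReal` discards negative values, so `θ` gives only the upper bound and `-θ` the lower
  -- one.
  constructor
  · have h1 := key (fun y => -θ y) hC1.neg hcs.neg
      (by rw [show (fun y => -θ y) = -θ from rfl, tsupport_neg]; exact hts.trans hab)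
      (fun y => by rw [abs_neg]; exact hb y)
    have h2 : ∫ y, v y * deriv (fun y => -θ y) y = -∫ y, v y * deriv θ y := by
      rw [← integral_neg]
      refine integral_congr_ae (Eventually.of_forall fun y => ?_)
      simp [deriv.fun_neg]
    linarith
  · exact key θ hC1 hcs (hts.trans hab) hb

/-- On an open interval, the essential oscillation is bounded by the variation. -/
theorem exists_null_abs_sub_le {v : ℝ → ℝ} {I : Set ℝ} (hI : IsOpen I) (hc : I.OrdConnected)
    (hv : LocallyIntegrableOn v I) {ε : ℝ} (hε : 0 ≤ ε)
    (h : variationOpen v I ≤ ENNReal.ofReal ε) :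
    ∃ N : Set ℝ, volume N = 0 ∧ ∀ s ∈ I \ N, ∀ t ∈ I \ N, |v s - v t| ≤ ε := by
  -- The ratio of outer to inner radius stays equal to 2, as needed for almost everywhere
  -- convergence of the mollifications.
  let φ : ℕ → ContDiffBump (0 : ℝ) := fun k =>
    ⟨1 / (k + 1) / 2, 1 / (k + 1), by positivity, half_lt_self (by positivity)⟩
  have hφ : Tendsto (fun k => (φ k).rOut) atTop (𝓝 0) := tendsto_one_div_add_atTop_nhds_zero_nat
  have hφ' : ∀ᶠ k in atTop, (φ k).rOut ≤ 2 * (φ k).rIn :=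
    Eventually.of_forall fun k => by simp only [φ]; linarith
  have hint : ∀ a b : ℝ, Icc a b ⊆ I → IntegrableOn v (Icc a b) := fun a b hab =>
    hv.integrableOn_compact_subset hab isCompact_Icc
  -- Rational endpoints leave countably many truncations, so a single null set serves all pairs `s`,
  -- `t`.
  have hae : ∀ᵐ x : ℝ, ∀ q : ℚ × ℚ, Icc (q.1 : ℝ) q.2 ⊆ I →
      Tendsto (fun k => ∫ y, (φ k).normed volume (x - y) • (Icc (q.1 : ℝ) q.2).indicator v y) atTop
        (𝓝 ((Icc (q.1 : ℝ) q.2).indicator v x)) := by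
    rw [ae_all_iff]
    intro q
    by_cases hq : Icc (q.1 : ℝ) q.2 ⊆ I
    · have := ContDiffBump.ae_convolution_tendsto_right_of_locallyIntegrable (μ := volume) hφ hφ'
        ((integrable_indicator_iff measurableSet_Icc).2 (hint q.1 q.2 hq)).locallyIntegrable
      filter_upwards [this] with x hx _
      simpa only [convolution_lsmul_swap] using hx
    · exact Eventually.of_forall fun x hx => absurd hx hq
  -- Unfolded, `hae` says that the complement of the set of convergence is null; this complement is
  -- `N`.
  refine ⟨_, hae, ?_⟩
  have key : ∀ s ∈ I, ∀ t ∈ I, s ≤ t →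
      (∀ x ∈ ({s, t} : Set ℝ), ∀ q : ℚ × ℚ, Icc (q.1 : ℝ) q.2 ⊆ I →
      Tendsto (fun k => ∫ y, (φ k).normed volume (x - y) • (Icc (q.1 : ℝ) q.2).indicator v y) atTop
        (𝓝 ((Icc (q.1 : ℝ) q.2).indicator v x))) → |v s - v t| ≤ ε := by
    intro s hs t ht hst hx
    obtain ⟨δ, hδ, hδI⟩ := Metric.isOpen_iff.1 hI s hs
    obtain ⟨δ', hδ', hδI'⟩ := Metric.isOpen_iff.1 hI t ht
    obtain ⟨a, ha, ha'⟩ := exists_rat_btwn (show s - δ < s by linarith)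
    obtain ⟨b, hb, hb'⟩ := exists_rat_btwn (show t < t + δ' by linarith)
    have haI : (a : ℝ) ∈ I := hδI (by rw [Metric.mem_ball, Real.dist_eq, abs_lt]; constructor <;> linarith)
    have hbI : (b : ℝ) ∈ I := hδI' (by rw [Metric.mem_ball, Real.dist_eq, abs_lt]; constructor <;> linarith)
    have hab : Icc (a : ℝ) b ⊆ I := hc.out haI hbI
    have h1 := hx s (by simp) (a, b) hab
    have h2 := hx t (by simp) (a, b) hab
    rw [indicator_of_mem (show s ∈ Icc (a : ℝ) b from ⟨ha'.le, (hst.trans_lt hb).le⟩)] at h1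
    rw [indicator_of_mem (show t ∈ Icc (a : ℝ) b from ⟨(ha'.trans_le hst).le, hb.le⟩)] at h2
    refine le_of_tendsto (h1.sub h2).abs ?_
    have e1 := hφ.eventually_lt_const (show (0 : ℝ) < s - a by linarith)
    have e2 := hφ.eventually_lt_const (show (0 : ℝ) < b - t by linarith)
    filter_upwards [e1, e2] with k hk1 hk2
    exact abs_convolution_sub_le hε h hab (hint a b hab) hst (φ k) (by linarith) (by linarith)
  rintro s ⟨hs, hsN⟩ t ⟨ht, htN⟩
  rw [notMem_compl_iff] at hsN htN
  rcases le_total s t with hst | hst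
  · refine key s hs t ht hst ?_
    rintro x (rfl | rfl)
    exacts [hsN, htN]
  · rw [abs_sub_comm]
    refine key t ht s hs hst ?_
    rintro x (rfl | rfl)
    exacts [htN, hsN]

/-- If the slice energy on an open set is less than `ε ≤ 1`, then there are no large jumps and
the variation is at most `ε`. -/
lemma variationOpen_le_of_sliceEnergy_lt {Ω U : Set (EuclideanSpace ℝ (Fin n))}
    {u : EuclideanSpace ℝ (Fin n) → EuclideanSpace ℝ (Fin n)} {ξ y : EuclideanSpace ℝ (Fin n)}
    {ε : ℝ≥0∞} (hε : ε ≤ 1) (h : sliceEnergy Ω u ξ y U < ε) :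
    variationOpen (slice u ξ y) (sliceSet U ξ y) ≤ ε := by
  -- A single large jump already costs 1; this is where `ε ≤ 1` enters.
  have h1 : sliceSet U ξ y ∩ jumpSetOne (sliceSet Ω ξ y) (slice u ξ y) = ∅ := by
    rw [← Set.encard_eq_zero, ← Order.lt_one_iff]
    have h2 : ((sliceSet U ξ y ∩ jumpSetOne (sliceSet Ω ξ y) (slice u ξ y)).encard : ℝ≥0∞) < 1 :=
      (le_add_self.trans_lt h).trans_le hε
    exact_mod_cast h2
  have h3 : sliceSet U ξ y \ jumpSetOne (sliceSet Ω ξ y) (slice u ξ y) = sliceSet U ξ y := by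
    rw [← Set.sdiff_inter_self_eq_sdiff, inter_comm, h1, sdiff_empty]
  have h4 : variation (sliceSet Ω ξ y) (slice u ξ y) (sliceSet U ξ y) < ε := by
    rw [← h3]
    exact le_self_add.trans_lt h
  -- Every open set competing in the infimum contains the slice of `U` and therefore admits more
  -- test functions.
  refine le_trans ?_ h4.le
  refine le_iInf fun V => le_iInf fun _ => le_iInf fun hUV => le_iInf fun _ => ?_
  refine iSup_mono fun φ => iSup_mono fun _ => iSup_mono fun _ => ?_
  refine iSup_le fun hφ => ?_
  exact le_iSup_of_le (hφ.trans hUV) le_rfl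

/-! ### The surface measure of the sphere and polar coordinates -/

lemma finrank_orthogonal_span {ξ : EuclideanSpace ℝ (Fin n)} (hξ : ξ ≠ 0) :
    Module.finrank ℝ (ℝ ∙ ξ)ᗮ = n - 1 := by
  have h := (ℝ ∙ ξ).finrank_add_finrank_orthogonal
  rw [finrank_span_singleton hξ, finrank_euclideanSpace_fin] at h
  omega

/-- Integration over lines parallel to a unit vector. -/
theorem lintegral_eq_lintegral_hyperplane {ξ : EuclideanSpace ℝ (Fin n)}
    (hξ : ξ ∈ unitSphere n) {f : EuclideanSpace ℝ (Fin n) → ℝ≥0∞} (hf : Measurable f) :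
    ∫⁻ z, f z = ∫⁻ y in hyperplane ξ, (∫⁻ t : ℝ, f (y + t • ξ)) ∂μHE[n - 1] := by
  have hξ1 : ‖ξ‖ = 1 := by simpa using hξ
  have hξ0 : ξ ≠ 0 := by
    rintro rfl
    simp at hξ1
  have hmp := ((ℝ ∙ ξ).measurePreserving_measurableEquivProd
    (0 : EuclideanSpace ℝ (Fin n))).symm
  rw [InnerProductSpace.euclideanHausdorffMeasure_eq_volume] at hmp
  have hfm : AEMeasurable (fun q : (ℝ ∙ ξ) × (ℝ ∙ ξ)ᗮ =>
      f (((ℝ ∙ ξ).measurableEquivProd (0 : EuclideanSpace ℝ (Fin n))).symm q))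
      ((volume : Measure (ℝ ∙ ξ)).prod volume) := (hf.comp hmp.measurable).aemeasurable
  rw [← hmp.lintegral_comp hf, Measure.volume_eq_prod, lintegral_prod_symm _ hfm]
  have hiso : Isometry (Subtype.val : (ℝ ∙ ξ)ᗮ → EuclideanSpace ℝ (Fin n)) := isometry_subtype_coe
  -- The inclusion of the orthogonal complement is an isometry, so it carries Lebesgue measure to
  -- Hausdorff measure on the hyperplane.
  have hmap : (volume : Measure (ℝ ∙ ξ)ᗮ).map Subtype.val =
      (μHE[n - 1] : Measure (EuclideanSpace ℝ (Fin n))).restrict (hyperplane ξ) := by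
    rw [← InnerProductSpace.euclideanHausdorffMeasure_eq_volume,
      hiso.map_euclideanHausdorffMeasure, finrank_orthogonal_span hξ0, Subtype.range_coe]
    congr 1
    ext y
    exact Submodule.mem_orthogonal_singleton_iff_inner_left
  have hme : MeasurableEmbedding (Subtype.val : (ℝ ∙ ξ)ᗮ → EuclideanSpace ℝ (Fin n)) :=
    MeasurableEmbedding.subtype_coe (ℝ ∙ ξ)ᗮ.closed_of_finiteDimensional.measurableSet
  rw [← hmap, hme.lintegral_map]
  refine lintegral_congr fun y => ?_
  have h3 := (LinearIsometryEquiv.toSpanUnitSingleton (𝕜 := ℝ) ξ hξ1).measurePreserving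
  have h4 : Measurable fun a : (ℝ ∙ ξ) =>
      f (((ℝ ∙ ξ).measurableEquivProd (0 : EuclideanSpace ℝ (Fin n))).symm (a, y)) :=
    hf.comp (hmp.measurable.comp measurable_prodMk_right)
  rw [← h3.lintegral_comp h4]
  refine lintegral_congr fun t => ?_
  simp [add_comm]

/-- Integration in polar coordinates. -/
theorem lintegral_eq_lintegral_toSphere (hn : 1 ≤ n) {f : EuclideanSpace ℝ (Fin n) → ℝ≥0∞}
    (hf : Measurable f) :
    ∫⁻ z, f z = ∫⁻ ξ : Metric.sphere (0 : EuclideanSpace ℝ (Fin n)) 1,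
      (∫⁻ t in Ioi (0 : ℝ), ENNReal.ofReal (t ^ (n - 1)) * f (t • (ξ : EuclideanSpace ℝ (Fin n))))
        ∂(volume : Measure (EuclideanSpace ℝ (Fin n))).toSphere := by
  have : Nontrivial (EuclideanSpace ℝ (Fin n)) := by
    have : Nonempty (Fin n) := ⟨⟨0, hn⟩⟩
    infer_instance
  have h1 : ∫⁻ z, f z = ∫⁻ z : ({0}ᶜ : Set (EuclideanSpace ℝ (Fin n))), f z
      ∂(volume.comap Subtype.val) := by
    rw [lintegral_subtype_comap (measurableSet_singleton _).compl, restrict_compl_singleton]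
  have hmp := (volume : Measure (EuclideanSpace ℝ (Fin n))).measurePreserving_homeomorphUnitSphereProd
  have h2 := MeasurePreserving.symm (homeomorphUnitSphereProd _).toMeasurableEquiv hmp
  have h5 := h2.lintegral_comp (hf.comp measurable_subtype_coe)
  simp only [Function.comp_apply] at h5
  rw [h1, ← h5, lintegral_prod]
  · refine lintegral_congr fun ξ => ?_
    rw [Measure.volumeIoiPow, lintegral_withDensity_eq_lintegral_mul]
    · rw [← lintegral_subtype_comap measurableSet_Ioi]
      simp
    · fun_prop
    · exact (hf.comp measurable_subtype_coe).comp (h2.measurable.comp measurable_prodMk_left)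
  · exact ((hf.comp measurable_subtype_coe).comp h2.measurable).aemeasurable

lemma volume_closedBall_eq {V : Type*} [NormedAddCommGroup V] [InnerProductSpace ℝ V]
    [FiniteDimensional ℝ V] [MeasurableSpace V] [BorelSpace V] {m : ℕ}
    (hm : Module.finrank ℝ V = m) (r : ℝ) :
    volume (Metric.closedBall (0 : V) r) =
      volume (Metric.closedBall (0 : EuclideanSpace ℝ (Fin m)) r) := by
  subst hm
  rw [← (stdOrthonormalBasis ℝ V).measurePreserving_repr.measure_preimage
    measurableSet_closedBall.nullMeasurableSet]
  congr 1
  ext z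
  simp

open scoped Pointwise in
/-- The open cone over a part `s` of the unit sphere lies in a tube of radius `diam s`. -/
lemma toSphere_le_mul_ediam_pow :
    ∃ C : ℝ≥0∞, C ≠ ∞ ∧ ∀ s : Set (Metric.sphere (0 : EuclideanSpace ℝ (Fin n)) 1),
      (volume : Measure (EuclideanSpace ℝ (Fin n))).toSphere s ≤
        C * Metric.ediam s ^ ((n - 1 : ℕ) : ℝ) := by
  refine ⟨n * (volume (Metric.closedBall (0 : EuclideanSpace ℝ (Fin 1)) 1) *
      volume (Metric.ball (0 : EuclideanSpace ℝ (Fin (n - 1))) 1)), ?_, fun s => ?_⟩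
  · exact ENNReal.mul_ne_top (by simp) (ENNReal.mul_ne_top measure_closedBall_lt_top.ne
      measure_ball_lt_top.ne)
  rcases s.eq_empty_or_nonempty with rfl | ⟨ξ₀, hξ₀⟩
  · simp
  have hb : Bornology.IsBounded s := Bornology.IsBounded.all s
  set d := Metric.diam s with hd
  have hdd : Metric.ediam s = ENNReal.ofReal d := by
    rw [hd, Metric.diam, ENNReal.ofReal_toReal hb.ediam_ne_top]
  have hd0 : 0 ≤ d := Metric.diam_nonneg
  set ν : EuclideanSpace ℝ (Fin n) := ξ₀.1 with hν
  have hν1 : ‖ν‖ = 1 := by simp [hν]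
  have hν0 : ν ≠ 0 := by
    intro h
    simp [h] at hν1
  -- The set `s` may be nonmeasurable; the cone formula is applied to this closed ball instead.
  have hs : s ⊆ Metric.closedBall ξ₀ d := fun ξ hξ => Metric.dist_le_diam_of_mem hb hξ hξ₀
  have hmp := ((ℝ ∙ ν).measurePreserving_measurableEquivProd
    (0 : EuclideanSpace ℝ (Fin n)))
  rw [InnerProductSpace.euclideanHausdorffMeasure_eq_volume] at hmp
  refine (measure_mono hs).trans ?_
  rw [Measure.toSphere_apply' _ measurableSet_closedBall, finrank_euclideanSpace_fin, mul_assoc]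
  gcongr
  have hsub : Ioo (0 : ℝ) 1 • (Subtype.val '' Metric.closedBall ξ₀ d) ⊆
      (ℝ ∙ ν).measurableEquivProd (0 : EuclideanSpace ℝ (Fin n)) ⁻¹'
        (Metric.closedBall 0 1 ×ˢ Metric.closedBall 0 d) := by
    rintro _ ⟨t, ht, _, ⟨ξ, hξ, rfl⟩, rfl⟩
    have hξ1 : ‖(ξ : EuclideanSpace ℝ (Fin n))‖ = 1 := by simp
    have ht1 : ‖t‖ ≤ 1 := by
      rw [Real.norm_eq_abs, abs_of_pos ht.1]
      exact ht.2.le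
    simp only [mem_preimage, Submodule.measurableEquivProd_apply, vsub_eq_sub, sub_zero, mem_prod,
      mem_closedBall_zero_iff, map_smul, norm_smul]
    constructor
    · refine mul_le_one₀ ht1 (norm_nonneg _) ?_
      exact (Submodule.norm_orthogonalProjectionOnto_apply_le _ _).trans hξ1.le
    -- The projection kills `ν`, so only `ξ - ν`, of length at most `d`, contributes.
    · have h0 : (ℝ ∙ ν)ᗮ.orthogonalProjectionOnto (ξ : EuclideanSpace ℝ (Fin n)) =
          (ℝ ∙ ν)ᗮ.orthogonalProjectionOnto ((ξ : EuclideanSpace ℝ (Fin n)) - ν) := by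
        have : (ℝ ∙ ν)ᗮ.orthogonalProjectionOnto ν = 0 := by
          apply Submodule.orthogonalProjectionOnto_orthogonal_apply_eq_zero
          exact Submodule.mem_span_singleton_self ν
        rw [map_sub, this, sub_zero]
      have h1 : ‖(ξ : EuclideanSpace ℝ (Fin n)) - ν‖ ≤ d := by
        rw [← dist_eq_norm]
        exact hξ
      rw [h0]
      calc ‖t‖ * _ ≤ 1 * ‖(ξ : EuclideanSpace ℝ (Fin n)) - ν‖ := by
            gcongr
            exact Submodule.norm_orthogonalProjectionOnto_apply_le _ _
        _ ≤ d := by rwa [one_mul]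
  refine (measure_mono hsub).trans ?_
  rw [hmp.measure_preimage (measurableSet_closedBall.prod measurableSet_closedBall).nullMeasurableSet,
    Measure.volume_eq_prod, Measure.prod_prod, volume_closedBall_eq (finrank_span_singleton hν0),
    volume_closedBall_eq (finrank_orthogonal_span hν0), Measure.addHaar_closedBall _ _ hd0,
    finrank_euclideanSpace_fin, hdd, ENNReal.rpow_natCast, ENNReal.ofReal_pow hd0, mul_assoc]
  exact le_of_eq (by ring)

/-- The two normalisations differ by a nonzero finite factor. The Lipschitz image estimate below is
applied to `μH`. -/
lemma euclideanHausdorffMeasure_eq_zero_iff {X : Type*} [EMetricSpace X] [MeasurableSpace X]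
    [BorelSpace X] {d : ℕ} {s : Set X} : μHE[d] s = 0 ↔ μH[d] s = 0 := by
  have h := Measure.addHaarScalarFactor_volume_hausdorffMeasure_ne_zero d
  rw [Measure.euclideanHausdorffMeasure_def, Measure.smul_apply]
  simp [ENNReal.smul_def, h]

/-- The polar coordinate measure on the sphere is controlled by the Hausdorff measure. -/
theorem map_toSphere_le :
    ∃ C : ℝ≥0∞, C ≠ ∞ ∧
      ((volume : Measure (EuclideanSpace ℝ (Fin n))).toSphere).map Subtype.val ≤
        C • (μHE[n - 1]).restrict (unitSphere n) := by
  obtain ⟨C, hC, h⟩ := toSphere_le_mul_ediam_pow (n := n)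
  set c := Measure.addHaarScalarFactor (volume : Measure (EuclideanSpace ℝ (Fin (n - 1))))
      μH[(n - 1 : ℕ)] with hc
  have hne : (c : ℝ≥0∞) ≠ 0 := by
    exact_mod_cast Measure.addHaarScalarFactor_volume_hausdorffMeasure_ne_zero (n - 1)
  -- `C + 1` replaces `C` so that the constant can be inverted.
  have hC1 : C + 1 ≠ 0 := by simp
  have hC2 : C + 1 ≠ ∞ := by simp [hC]
  have h1 : (C + 1)⁻¹ • (volume : Measure (EuclideanSpace ℝ (Fin n))).toSphere ≤
      μH[((n - 1 : ℕ) : ℝ)] := by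
    -- Mass distribution principle; the diameter threshold 1 is arbitrary, since the bound holds for
    -- all sets.
    refine Measure.le_hausdorffMeasure _ _ 1 one_pos fun s _ => ?_
    rw [Measure.smul_apply, smul_eq_mul]
    calc (C + 1)⁻¹ * (volume : Measure (EuclideanSpace ℝ (Fin n))).toSphere s
        ≤ (C + 1)⁻¹ * ((C + 1) * Metric.ediam s ^ ((n - 1 : ℕ) : ℝ)) := by
          gcongr
          refine (h s).trans ?_
          gcongr
          exact le_self_add
      _ = _ := by rw [← mul_assoc, ENNReal.inv_mul_cancel hC1 hC2, one_mul]
  refine ⟨(C + 1) * (c : ℝ≥0∞)⁻¹, ENNReal.mul_ne_top hC2 (by simpa using hne), ?_⟩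
  refine Measure.le_iff.2 fun A hA => ?_
  rw [Measure.map_apply measurable_subtype_coe hA, Measure.smul_apply, smul_eq_mul,
    Measure.restrict_apply hA]
  have h2 := h1 (Subtype.val ⁻¹' A)
  rw [Measure.smul_apply, smul_eq_mul] at h2
  have h3 : (μHE[n - 1] : Measure (EuclideanSpace ℝ (Fin n))) (A ∩ unitSphere n) =
      c * μH[((n - 1 : ℕ) : ℝ)]
        (Subtype.val ⁻¹' A : Set (Metric.sphere (0 : EuclideanSpace ℝ (Fin n)) 1)) := by
    have h4 := (isometry_subtype_coe (s := unitSphere n)).euclideanHausdorffMeasure_preimage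
      (d := n - 1) A
    rw [Subtype.range_coe] at h4
    rw [← h4, Measure.euclideanHausdorffMeasure_def, Measure.smul_apply]
    rfl
  rw [h3, mul_assoc, ← mul_assoc _ (c : ℝ≥0∞), ENNReal.inv_mul_cancel hne (by simp), one_mul]
  calc _ = (C + 1) * ((C + 1)⁻¹ *
        (volume : Measure (EuclideanSpace ℝ (Fin n))).toSphere (Subtype.val ⁻¹' A)) := by
        rw [← mul_assoc, ENNReal.mul_inv_cancel hC1 hC2, one_mul]
    _ ≤ _ := by gcongr

/-- The difference splits into `z - w` scaled by `‖z‖⁻¹` and a multiple of `w` controlled by the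
reverse triangle inequality; each part has norm at most `‖z - w‖ / ‖z‖`. This serves to project a
piece of an affine hyperplane centrally onto the sphere. -/
lemma lipschitzOnWith_normalize {V : Type*} [NormedAddCommGroup V] [NormedSpace ℝ V]
    {h : ℝ} (hh : 0 < h) :
    LipschitzOnWith (2 / h).toNNReal (fun z : V => ‖z‖⁻¹ • z) {z | h ≤ ‖z‖} := by
  refine LipschitzOnWith.of_dist_le_mul fun z hz w hw => ?_
  have hz' : 0 < ‖z‖ := hh.trans_le hz
  have hw' : 0 < ‖w‖ := hh.trans_le hw
  rw [Real.coe_toNNReal _ (by positivity), dist_eq_norm, dist_eq_norm]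
  have h1 : ‖z‖⁻¹ • z - ‖w‖⁻¹ • w = ‖z‖⁻¹ • (z - w) + (‖z‖⁻¹ * (‖w‖ - ‖z‖) * ‖w‖⁻¹) • w := by
    have : ‖z‖⁻¹ * (‖w‖ - ‖z‖) * ‖w‖⁻¹ = ‖z‖⁻¹ - ‖w‖⁻¹ := by field_simp
    rw [this]
    module
  have h2 : ‖(‖z‖⁻¹ * (‖w‖ - ‖z‖) * ‖w‖⁻¹) • w‖ ≤ ‖z‖⁻¹ * ‖z - w‖ := by
    rw [norm_smul, norm_mul, norm_mul, norm_inv, norm_inv, norm_norm, norm_norm, mul_assoc,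
      inv_mul_cancel₀ hw'.ne', mul_one, norm_sub_rev z w]
    gcongr
    exact abs_norm_sub_norm_le _ _
  calc _ ≤ ‖z‖⁻¹ * ‖z - w‖ + ‖z‖⁻¹ * ‖z - w‖ := by
        rw [h1]
        refine (norm_add_le _ _).trans (add_le_add ?_ h2)
        rw [norm_smul, norm_inv, norm_norm]
    _ = 2 / ‖z‖ * ‖z - w‖ := by ring
    _ ≤ 2 / h * ‖z - w‖ := by
        gcongr
        exact hz

open scoped Pointwise in
/-- A subset of the sphere that is null in polar coordinates is `H^{n-1}`-null. -/
theorem hausdorff_null_of_toSphere_null (hn : 1 ≤ n)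
    {s : Set (Metric.sphere (0 : EuclideanSpace ℝ (Fin n)) 1)}
    (hs : (volume : Measure (EuclideanSpace ℝ (Fin n))).toSphere s = 0) :
    (μHE[n - 1] : Measure (EuclideanSpace ℝ (Fin n))) (Subtype.val '' s) = 0 := by
  set s' := toMeasurable (volume : Measure (EuclideanSpace ℝ (Fin n))).toSphere s with hs'
  have hcone : volume (Ioo (0 : ℝ) 1 • (Subtype.val '' s' : Set (EuclideanSpace ℝ (Fin n)))) = 0 := by
    have h1 := Measure.toSphere_apply' (volume : Measure (EuclideanSpace ℝ (Fin n)))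
      (measurableSet_toMeasurable (volume : Measure (EuclideanSpace ℝ (Fin n))).toSphere s)
    rw [measure_toMeasurable, hs, finrank_euclideanSpace_fin] at h1
    rcases mul_eq_zero.1 h1.symm with h | h
    · exact absurd h (by simp; omega)
    · exact h
  set T := toMeasurable volume
    (Ioo (0 : ℝ) 1 • (Subtype.val '' s' : Set (EuclideanSpace ℝ (Fin n)))) with hT
  have hT0 : volume T = 0 := by rw [hT, measure_toMeasurable, hcone]
  -- By Fubini, some affine hyperplane orthogonal to `v`, at a height `H` in `(0, 1)`, meets the
  -- null cone in an `H^{n-1}`-null set. A direction with `⟨ξ, v⟩ > 1` reaches that height at a time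
  -- `t < 1`, still inside the cone, so it is the central projection of a point of this null set.
  have key : ∀ v : EuclideanSpace ℝ (Fin n), v ≠ 0 →
      (μHE[n - 1] : Measure (EuclideanSpace ℝ (Fin n)))
        ((Subtype.val '' s) ∩ {ξ | 1 < inner ℝ ξ v}) = 0 := by
    intro v hv
    have hv0 : 0 < ‖v‖ := norm_pos_iff.2 hv
    have hmp := ((ℝ ∙ v).measurePreserving_measurableEquivProd
      (0 : EuclideanSpace ℝ (Fin n))).symm
    rw [InnerProductSpace.euclideanHausdorffMeasure_eq_volume] at hmp
    have h1 := hmp.measure_preimage_equiv T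
    rw [hT0, Measure.volume_eq_prod] at h1
    have h2 := Measure.measure_ae_null_of_prod_null h1
    have hO : IsOpen {a : (ℝ ∙ v) | inner ℝ (a : EuclideanSpace ℝ (Fin n)) v ∈ Ioo (0 : ℝ) 1} :=
      isOpen_Ioo.preimage (by fun_prop)
    have hOne : {a : (ℝ ∙ v) |
        inner ℝ (a : EuclideanSpace ℝ (Fin n)) v ∈ Ioo (0 : ℝ) 1}.Nonempty := by
      refine ⟨⟨(2 * ‖v‖ ^ 2)⁻¹ • v, Submodule.smul_mem _ _ (Submodule.mem_span_singleton_self v)⟩, ?_⟩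
      have : (2 * ‖v‖ ^ 2)⁻¹ * ‖v‖ ^ 2 = 1 / 2 := by field_simp
      simp only [mem_ofPred_eq, real_inner_smul_left, real_inner_self_eq_norm_sq, this]
      norm_num
    obtain ⟨a, ha, ha0⟩ : ∃ a : (ℝ ∙ v), inner ℝ (a : EuclideanSpace ℝ (Fin n)) v ∈ Ioo (0 : ℝ) 1 ∧
        volume (Prod.mk a ⁻¹' (((ℝ ∙ v).measurableEquivProd
          (0 : EuclideanSpace ℝ (Fin n))).symm ⁻¹' T)) = 0 := by
      by_contra! hcon
      refine hO.measure_ne_zero volume hOne (measure_mono_null (fun a ha => ?_) h2)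
      exact hcon a ha
    set H : ℝ := inner ℝ (a : EuclideanSpace ℝ (Fin n)) v with hH
    set h := H / ‖v‖ with hh
    have hh0 : 0 < h := div_pos ha.1 hv0
    set S : Set (EuclideanSpace ℝ (Fin n)) := (fun b : (ℝ ∙ v)ᗮ =>
      (a : EuclideanSpace ℝ (Fin n)) + b) '' (Prod.mk a ⁻¹' (((ℝ ∙ v).measurableEquivProd
          (0 : EuclideanSpace ℝ (Fin n))).symm ⁻¹' T)) with hS
    have hx0 : (μHE[n - 1] : Measure (EuclideanSpace ℝ (Fin n))) S = 0 := by
      have hiso : Isometry (fun b : (ℝ ∙ v)ᗮ => (a : EuclideanSpace ℝ (Fin n)) + b) :=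
        (isometry_add_left _).comp isometry_subtype_coe
      rw [hS, hiso.euclideanHausdorffMeasure_image, ← finrank_orthogonal_span hv,
        InnerProductSpace.euclideanHausdorffMeasure_eq_volume]
      exact ha0
    have hSn : S ⊆ {z | h ≤ ‖z‖} := by
      rintro _ ⟨b, _, rfl⟩
      have h3 := real_inner_le_norm ((a : EuclideanSpace ℝ (Fin n)) + b) v
      rw [inner_add_left, Submodule.mem_orthogonal_singleton_iff_inner_left.1 b.2, add_zero] at h3
      exact (div_le_iff₀ hv0).2 h3
    have hsub : (Subtype.val '' s) ∩ {ξ : EuclideanSpace ℝ (Fin n) | 1 < inner ℝ ξ v} ⊆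
        (fun z => ‖z‖⁻¹ • z) '' S := by
      rintro _ ⟨⟨ξ, hξ, rfl⟩, hξv⟩
      have hξv' : (1 : ℝ) < inner ℝ (ξ : EuclideanSpace ℝ (Fin n)) v := hξv
      have hpos : (0 : ℝ) < inner ℝ (ξ : EuclideanSpace ℝ (Fin n)) v := one_pos.trans hξv'
      set t : ℝ := H / inner ℝ (ξ : EuclideanSpace ℝ (Fin n)) v with ht
      have ht0 : 0 < t := div_pos ha.1 hpos
      have ht1 : t < 1 := (div_lt_one hpos).2 (ha.2.trans hξv')
      have hperp : t • (ξ : EuclideanSpace ℝ (Fin n)) - a ∈ (ℝ ∙ v)ᗮ := by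
        rw [Submodule.mem_orthogonal_singleton_iff_inner_left, inner_sub_left,
          real_inner_smul_left, ht, div_mul_cancel₀ _ hpos.ne', sub_self]
      refine ⟨t • (ξ : EuclideanSpace ℝ (Fin n)), ⟨⟨_, hperp⟩, ?_, by simp⟩, ?_⟩
      · have hT : t • (ξ : EuclideanSpace ℝ (Fin n)) ∈ T :=
          subset_toMeasurable _ _ ⟨t, ⟨ht0, ht1⟩, _, ⟨ξ, subset_toMeasurable _ _ hξ, rfl⟩, rfl⟩
        simpa using hT
      · have : ‖(ξ : EuclideanSpace ℝ (Fin n))‖ = 1 := by simp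
        simp only [norm_smul, this, mul_one, Real.norm_eq_abs, abs_of_pos ht0, smul_smul]
        rw [inv_mul_cancel₀ ht0.ne', one_smul]
    refine measure_mono_null hsub ?_
    rw [euclideanHausdorffMeasure_eq_zero_iff] at hx0 ⊢
    have h5 := ((lipschitzOnWith_normalize hh0).mono hSn).hausdorffMeasure_image_le
      (d := ((n - 1 : ℕ) : ℝ)) (by positivity)
    rw [hx0, mul_zero] at h5
    exact le_antisymm h5 zero_le
  -- Countably many `v` suffice: any `v` within distance 1 of `2 ξ` satisfies `⟨ξ, v⟩ > 1`.
  refine measure_mono_null (t := ⋃ k : ℕ, if TopologicalSpace.denseSeq (EuclideanSpace ℝ (Fin n)) k = 0 then ∅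
    else (Subtype.val '' s) ∩
      {ξ | 1 < inner ℝ ξ (TopologicalSpace.denseSeq (EuclideanSpace ℝ (Fin n)) k)}) ?_ ?_
  · intro ξ hξ
    have hξ1 : ‖ξ‖ = 1 := by
      obtain ⟨ξ', _, rfl⟩ := hξ
      simp
    obtain ⟨k, hk⟩ := (TopologicalSpace.denseRange_denseSeq (EuclideanSpace ℝ (Fin n))).exists_dist_lt
      ((2 : ℝ) • ξ) one_pos
    set w := TopologicalSpace.denseSeq (EuclideanSpace ℝ (Fin n)) k with hw
    have h1 : 1 < inner ℝ ξ w := by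
      have h2 : inner ℝ ξ ((2 : ℝ) • ξ - w) ≤ ‖ξ‖ * ‖(2 : ℝ) • ξ - w‖ := real_inner_le_norm _ _
      rw [inner_sub_right, real_inner_smul_right, real_inner_self_eq_norm_sq, hξ1,
        ← dist_eq_norm] at h2
      linarith
    have hw0 : w ≠ 0 := by
      intro h0
      rw [h0, inner_zero_right] at h1
      linarith
    refine mem_iUnion.2 ⟨k, ?_⟩
    rw [if_neg hw0]
    exact ⟨hξ, h1⟩
  · refine measure_iUnion_null fun k => ?_
    split_ifs with h0
    · simp
    · exact key _ h0

/-! ### Pairs of points with large longitudinal difference quotient -/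

/-- An almost everywhere property holds almost everywhere on almost all parallel lines. -/
lemma ae_hyperplane_of_ae {ξ : EuclideanSpace ℝ (Fin n)} (hξ : ξ ∈ unitSphere n)
    {P : EuclideanSpace ℝ (Fin n) → Prop} (hP : ∀ᵐ z, P z) :
    ∀ᵐ y ∂(μHE[n - 1].restrict (hyperplane ξ)), ∀ᵐ t : ℝ, P (y + t • ξ) := by
  -- The exceptional set need not be measurable, so Fubini is applied to a measurable null hull.
  set N := toMeasurable (volume : Measure (EuclideanSpace ℝ (Fin n))) {z | ¬ P z} with hN
  have hNm : MeasurableSet N := measurableSet_toMeasurable _ _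
  have hN0 : volume N = 0 := by rw [hN, measure_toMeasurable]; exact hP
  have hf : Measurable (N.indicator (1 : EuclideanSpace ℝ (Fin n) → ℝ≥0∞)) :=
    measurable_one.indicator hNm
  have h1 := lintegral_eq_lintegral_hyperplane hξ hf
  rw [lintegral_indicator_one hNm, hN0] at h1
  have hm : Measurable fun q : EuclideanSpace ℝ (Fin n) × ℝ =>
      N.indicator (1 : EuclideanSpace ℝ (Fin n) → ℝ≥0∞) (q.1 + q.2 • ξ) :=
    hf.comp (by fun_prop)
  have h2 := (lintegral_eq_zero_iff hm.lintegral_prod_right').1 h1.symm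
  filter_upwards [h2] with y hy
  have h3 := (lintegral_eq_zero_iff (hm.comp measurable_prodMk_left)).1 hy
  filter_upwards [h3] with t ht
  by_contra hcon
  have hmem : y + t • ξ ∈ N := subset_toMeasurable _ _ hcon
  simp [indicator_of_mem hmem] at ht

/-- An almost everywhere property holds almost everywhere on almost all rays. -/
lemma ae_toSphere_of_ae (hn : 1 ≤ n) {P : EuclideanSpace ℝ (Fin n) → Prop} (hP : ∀ᵐ z, P z) :
    ∀ᵐ ξ : Metric.sphere (0 : EuclideanSpace ℝ (Fin n)) 1
      ∂(volume : Measure (EuclideanSpace ℝ (Fin n))).toSphere,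
      ∀ᵐ t ∂(volume.restrict (Ioi (0 : ℝ))), P (t • (ξ : EuclideanSpace ℝ (Fin n))) := by
  set N := toMeasurable (volume : Measure (EuclideanSpace ℝ (Fin n))) {z | ¬ P z} with hN
  have hNm : MeasurableSet N := measurableSet_toMeasurable _ _
  have hN0 : volume N = 0 := by rw [hN, measure_toMeasurable]; exact hP
  have hf : Measurable (N.indicator (1 : EuclideanSpace ℝ (Fin n) → ℝ≥0∞)) :=
    measurable_one.indicator hNm
  have h1 := lintegral_eq_lintegral_toSphere hn hf
  rw [lintegral_indicator_one hNm, hN0] at h1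
  have hm : Measurable fun q : Metric.sphere (0 : EuclideanSpace ℝ (Fin n)) 1 × ℝ =>
      ENNReal.ofReal (q.2 ^ (n - 1)) *
        N.indicator (1 : EuclideanSpace ℝ (Fin n) → ℝ≥0∞) (q.2 • (q.1 : EuclideanSpace ℝ (Fin n))) :=
    (by fun_prop : Measurable _).mul (hf.comp (by fun_prop))
  have h2 := (lintegral_eq_zero_iff hm.lintegral_prod_right').1 h1.symm
  filter_upwards [h2] with ξ hξ
  have h3 := (lintegral_eq_zero_iff (hm.comp measurable_prodMk_left)).1 hξ
  filter_upwards [h3, ae_restrict_mem measurableSet_Ioi] with t ht ht0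
  by_contra hcon
  have hmem : t • (ξ : EuclideanSpace ℝ (Fin n)) ∈ N := subset_toMeasurable _ _ hcon
  have ht0' : 0 < t ^ (n - 1) := pow_pos ht0 _
  simp only [Function.comp_apply, indicator_of_mem hmem, Pi.one_apply, Pi.zero_apply, mul_one,
    ENNReal.ofReal_eq_zero] at ht
  linarith

/-- Pairs of points of a ball along which the difference quotient of `g` in the direction of the
pair is larger than `ε`. -/
def badPairs (g : EuclideanSpace ℝ (Fin n) → EuclideanSpace ℝ (Fin n))
    (x : EuclideanSpace ℝ (Fin n)) (R ε : ℝ) :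
    Set (EuclideanSpace ℝ (Fin n) × EuclideanSpace ℝ (Fin n)) :=
  {p | p.1 ∈ Metric.ball x R ∧ p.2 ∈ Metric.ball x R ∧
    ε * ‖p.1 - p.2‖ < |inner ℝ (g p.1 - g p.2) (p.1 - p.2)|}

lemma measurableSet_badPairs {g : EuclideanSpace ℝ (Fin n) → EuclideanSpace ℝ (Fin n)}
    (hg : Measurable g) (x : EuclideanSpace ℝ (Fin n)) (R ε : ℝ) :
    MeasurableSet (badPairs g x R ε) := by
  refine (measurable_fst measurableSet_ball).inter ((measurable_snd measurableSet_ball).inter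
    (measurableSet_lt (measurable_const.mul (measurable_fst.sub measurable_snd).norm) ?_))
  have h1 : Measurable fun p : EuclideanSpace ℝ (Fin n) × EuclideanSpace ℝ (Fin n) =>
      inner ℝ (g p.1 - g p.2) (p.1 - p.2) :=
    ((hg.comp measurable_fst).sub (hg.comp measurable_snd)).inner
      (measurable_fst.sub measurable_snd)
  exact h1.abs

/-- Connectedness of the chords of a ball lets small variation control the oscillation along the
whole chord. -/
lemma convex_sliceSet {U : Set (EuclideanSpace ℝ (Fin n))} (hU : Convex ℝ U)
    (ξ y : EuclideanSpace ℝ (Fin n)) : Convex ℝ (sliceSet U ξ y) := by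
  intro s hs t ht a b ha hb hab
  have h := hU hs ht ha hb hab
  have h2 : a • (y + s • ξ) + b • (y + t • ξ) = y + (a • s + b • t) • ξ := by
    rw [show a • (y + s • ξ) + b • (y + t • ξ) = (a + b) • y + (a • s + b • t) • ξ by
      rw [smul_eq_mul, smul_eq_mul]; module, hab, one_smul]
  rw [h2] at h
  exact h

lemma isOpen_sliceSet {U : Set (EuclideanSpace ℝ (Fin n))} (hU : IsOpen U)
    (ξ y : EuclideanSpace ℝ (Fin n)) : IsOpen (sliceSet U ξ y) :=
  hU.preimage (by fun_prop)

/-- On a single line, the measure of the bad pairs is controlled by the slice energy. -/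
lemma lintegral_badPairs_line_le (hn : 1 ≤ n) {Ω : Set (EuclideanSpace ℝ (Fin n))}
    {u g : EuclideanSpace ℝ (Fin n) → EuclideanSpace ℝ (Fin n)}
    {x : EuclideanSpace ℝ (Fin n)} {R ε : ℝ} (hR : 0 < R) (hε : 0 < ε) (hε1 : ε ≤ 1)
    (hB : Metric.ball x R ⊆ Ω) {ξ y : EuclideanSpace ℝ (Fin n)} (hξ : ξ ∈ unitSphere n)
    (hv : IsBVLoc (sliceSet Ω ξ y) (slice u ξ y))
    (hug : ∀ᵐ s : ℝ, y + s • ξ ∈ Ω → u (y + s • ξ) = g (y + s • ξ)) :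
    ∫⁻ s : ℝ, (∫⁻ t in Ioi (0 : ℝ), ENNReal.ofReal (t ^ (n - 1)) *
      (badPairs g x R ε).indicator 1 (y + s • ξ, y + s • ξ + t • ξ)) ≤
      ENNReal.ofReal ((2 * R) ^ (n + 1)) * (ENNReal.ofReal ε)⁻¹ *
        sliceEnergy Ω u ξ y (Metric.ball x R) := by
  have hξ1 : ‖ξ‖ = 1 := by simpa using hξ
  have hεpos : ENNReal.ofReal ε ≠ 0 := by simpa using hε
  rcases lt_or_ge (sliceEnergy Ω u ξ y (Metric.ball x R)) (ENNReal.ofReal ε) with he | he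
  · have h1 := variationOpen_le_of_sliceEnergy_lt (by simpa using hε1) he
    obtain ⟨N, hN0, hN⟩ := exists_null_abs_sub_le (isOpen_sliceSet Metric.isOpen_ball ξ y)
      (convex_sliceSet (convex_ball x R) ξ y).ordConnected
      (hv.1.mono_set fun s hs => hB hs) hε.le h1
    have hae : ∀ᵐ s : ℝ, s ∉ N ∧ (y + s • ξ ∈ Ω → u (y + s • ξ) = g (y + s • ξ)) := by
      filter_upwards [measure_eq_zero_iff_ae_notMem.1 hN0, hug] with s h1 h2 using ⟨h1, h2⟩
    have hzero : ∫⁻ s : ℝ, (∫⁻ t in Ioi (0 : ℝ), ENNReal.ofReal (t ^ (n - 1)) *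
        (badPairs g x R ε).indicator 1 (y + s • ξ, y + s • ξ + t • ξ)) = 0 := by
      refine lintegral_eq_zero_of_ae_eq_zero ?_
      filter_upwards [hae] with s hs
      refine lintegral_eq_zero_of_ae_eq_zero ?_
      -- Translation invariance: for almost every `t` the second point `s + t` is good as well.
      have hae2 := (measurePreserving_add_left volume s).quasiMeasurePreserving.ae hae
      filter_upwards [ae_restrict_of_ae hae2, ae_restrict_mem measurableSet_Ioi] with t ht ht0
      have ht0' : 0 < t := ht0
      rw [indicator_of_notMem, mul_zero]
      · rfl
      rintro ⟨hp, hq, hpq⟩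
      have heq : y + s • ξ + t • ξ = y + (s + t) • ξ := by module
      rw [heq] at hq hpq
      have hdiff : y + s • ξ - (y + (s + t) • ξ) = (-t) • ξ := by module
      simp only [hdiff, norm_smul, hξ1, mul_one, norm_neg, Real.norm_eq_abs,
        abs_of_pos ht0', real_inner_smul_right] at hpq
      rw [← hs.2 (hB hp), ← ht.2 (hB hq), abs_mul, abs_neg, abs_of_pos ht0', inner_sub_left] at hpq
      have h3 := hN s ⟨hp, hs.1⟩ (s + t) ⟨hq, ht.1⟩
      simp only [slice] at h3
      nlinarith
    rw [hzero]
    exact zero_le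
  -- Markov case: energy over `ε` is at least 1, so a crude bound suffices. Here `s` ranges in an
  -- interval of length `2 R`, `t` in `(0, 2 R)`, and the weight is at most `(2 R) ^ (n - 1)`.
  · set c : ℝ := inner ℝ (x - y) ξ with hc
    have hball : ∀ s : ℝ, y + s • ξ ∈ Metric.ball x R → s ∈ Ioo (c - R) (c + R) := by
      intro s hs
      have h1 : inner ℝ (y + s • ξ - x) ξ = s - c := by
        rw [hc, inner_sub_left, inner_sub_left, inner_add_left, real_inner_smul_left,
          real_inner_self_eq_norm_sq, hξ1]
        ring
      have h2 := abs_real_inner_le_norm (y + s • ξ - x) ξ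
      rw [h1, hξ1, mul_one, ← dist_eq_norm] at h2
      have h3 := abs_lt.1 (h2.trans_lt hs)
      constructor <;> linarith
    have hbound : ∫⁻ s : ℝ, (∫⁻ t in Ioi (0 : ℝ), ENNReal.ofReal (t ^ (n - 1)) *
        (badPairs g x R ε).indicator 1 (y + s • ξ, y + s • ξ + t • ξ)) ≤
        ENNReal.ofReal ((2 * R) ^ (n + 1)) := by
      have hs1 : ∀ s : ℝ, (∫⁻ t in Ioi (0 : ℝ), ENNReal.ofReal (t ^ (n - 1)) *
          (badPairs g x R ε).indicator 1 (y + s • ξ, y + s • ξ + t • ξ)) ≤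
          (Ioo (c - R) (c + R)).indicator (fun _ => ENNReal.ofReal ((2 * R) ^ n)) s := by
        intro s
        by_cases hs : s ∈ Ioo (c - R) (c + R)
        · rw [indicator_of_mem hs]
          have hle : ∀ t ∈ Ioi (0 : ℝ), ENNReal.ofReal (t ^ (n - 1)) *
              (badPairs g x R ε).indicator 1 (y + s • ξ, y + s • ξ + t • ξ) ≤
              (Ioo 0 (2 * R)).indicator (fun _ => ENNReal.ofReal ((2 * R) ^ (n - 1))) t := by
            intro t ht
            by_cases hb : (y + s • ξ, y + s • ξ + t • ξ) ∈ badPairs g x R ε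
            · have heq : y + s • ξ + t • ξ = y + (s + t) • ξ := by module
              have h1 := hball (s + t) (heq ▸ hb.2.1)
              have ht2 : t < 2 * R := by linarith [h1.2, hs.1]
              have ht1 : 0 < t := ht
              rw [indicator_of_mem hb, indicator_of_mem (show t ∈ Ioo 0 (2 * R) from ⟨ht, ht2⟩)]
              simp only [Pi.one_apply, mul_one]
              gcongr
            · rw [indicator_of_notMem hb, mul_zero]
              exact zero_le
          calc _ ≤ ∫⁻ t in Ioi (0 : ℝ),
                (Ioo 0 (2 * R)).indicator (fun _ => ENNReal.ofReal ((2 * R) ^ (n - 1))) t :=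
                setLIntegral_mono' measurableSet_Ioi hle
            _ ≤ ∫⁻ t, (Ioo 0 (2 * R)).indicator (fun _ => ENNReal.ofReal ((2 * R) ^ (n - 1))) t :=
                setLIntegral_le_lintegral _ _
            _ = ENNReal.ofReal ((2 * R) ^ n) := by
                rw [lintegral_indicator_const measurableSet_Ioo, Real.volume_Ioo,
                  ← ENNReal.ofReal_mul (by positivity), sub_zero, ← pow_succ, Nat.sub_add_cancel hn]
        · rw [indicator_of_notMem hs, nonpos_iff_eq_zero]
          refine lintegral_eq_zero_of_ae_eq_zero (Eventually.of_forall fun t => ?_)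
          have hb : (y + s • ξ, y + s • ξ + t • ξ) ∉ badPairs g x R ε :=
            fun hb => hs (hball s hb.1)
          simp only [indicator_of_notMem hb, mul_zero, Pi.zero_apply]
      refine (lintegral_mono hs1).trans ?_
      rw [lintegral_indicator_const measurableSet_Ioo, Real.volume_Ioo,
        ← ENNReal.ofReal_mul (by positivity), pow_succ]
      exact le_of_eq (by congr 2; ring)
    refine hbound.trans ?_
    rw [mul_assoc]
    refine le_mul_of_one_le_right zero_le ?_
    rw [← ENNReal.inv_mul_cancel hεpos ENNReal.ofReal_ne_top]
    gcongr

/-- The energy of a ball is bounded by `μ̂¹` of the closed ball. -/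
lemma lintegral_sliceEnergy_ball_le_muHat {Ω : Set (EuclideanSpace ℝ (Fin n))}
    {u : EuclideanSpace ℝ (Fin n) → EuclideanSpace ℝ (Fin n)}
    {x : EuclideanSpace ℝ (Fin n)} {R : ℝ} (hR : 0 < R) :
    ∫⁻ ξ in unitSphere n, (∫⁻ y in hyperplane ξ, sliceEnergy Ω u ξ y (Metric.ball x R) ∂μHE[n - 1])
      ∂μHE[n - 1] ≤ muHat Ω u 1 (Metric.closedBall x R) := by
  refine le_iInf fun U => le_iInf fun _ => le_iInf fun hBU => le_iInf fun _ => ?_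
  have hfam : IsBallFamily U {Metric.ball x R} := by
    refine ⟨?_, ?_, by simp⟩
    · simpa using ⟨x, R, hR, rfl⟩
    · simpa using Metric.ball_subset_closedBall.trans hBU
  refine le_iSup_of_le {Metric.ball x R} (le_iSup_of_le hfam ?_)
  simp only [Finset.sum_singleton, ENNReal.rpow_one, div_one]
  refine lintegral_mono fun ξ => ?_
  refine le_iInf fun V => le_iInf fun _ => le_iInf fun hV => le_iInf fun _ => ?_
  unfold muDirOpen
  split_ifs
  · refine lintegral_mono fun y => ?_
    have hsub : sliceSet (Metric.ball x R) ξ y ⊆ sliceSet V ξ y := fun t ht => hV ht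
    refine add_le_add ?_ ?_
    · refine iInf_mono fun W => iInf_mono fun _ => ?_
      refine le_iInf fun hW => ?_
      exact iInf_le_of_le ((sdiff_subset_sdiff_left hsub).trans hW) le_rfl
    · have : (sliceSet (Metric.ball x R) ξ y ∩ jumpSetOne (sliceSet Ω ξ y) (slice u ξ y)).encard ≤
          (sliceSet V ξ y ∩ jumpSetOne (sliceSet Ω ξ y) (slice u ξ y)).encard :=
        encard_le_encard (inter_subset_inter_left _ hsub)
      exact ENat.toENNReal_le.2 this
  · exact le_top

/-- Integration over pairs of points, in polar coordinates for the difference. -/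
lemma lintegral_prod_eq_lintegral_lines (hn : 1 ≤ n)
    {I : EuclideanSpace ℝ (Fin n) × EuclideanSpace ℝ (Fin n) → ℝ≥0∞} (hI : Measurable I) :
    ∫⁻ p, I p ∂((volume : Measure (EuclideanSpace ℝ (Fin n))).prod volume) =
      ∫⁻ ξ : Metric.sphere (0 : EuclideanSpace ℝ (Fin n)) 1,
      (∫⁻ y in hyperplane (ξ : EuclideanSpace ℝ (Fin n)), (∫⁻ s : ℝ,
        (∫⁻ t in Ioi (0 : ℝ), ENNReal.ofReal (t ^ (n - 1)) *
          I (y + s • (ξ : EuclideanSpace ℝ (Fin n)),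
            y + s • (ξ : EuclideanSpace ℝ (Fin n)) + t • (ξ : EuclideanSpace ℝ (Fin n)))))
        ∂μHE[n - 1]) ∂(volume : Measure (EuclideanSpace ℝ (Fin n))).toSphere := by
  have hF : Measurable fun q : (EuclideanSpace ℝ (Fin n) ×
      Metric.sphere (0 : EuclideanSpace ℝ (Fin n)) 1) × ℝ =>
      ENNReal.ofReal (q.2 ^ (n - 1)) * I (q.1.1, q.1.1 + q.2 • (q.1.2 : EuclideanSpace ℝ (Fin n))) := by
    refine Measurable.mul (by fun_prop) (hI.comp ?_)
    fun_prop
  have hF' : Measurable fun q : EuclideanSpace ℝ (Fin n) ×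
      Metric.sphere (0 : EuclideanSpace ℝ (Fin n)) 1 => ∫⁻ t in Ioi (0 : ℝ),
        ENNReal.ofReal (t ^ (n - 1)) * I (q.1, q.1 + t • (q.2 : EuclideanSpace ℝ (Fin n))) :=
    hF.lintegral_prod_right'
  have h1 : ∀ p, ∫⁻ q, I (p, q) = ∫⁻ ξ : Metric.sphere (0 : EuclideanSpace ℝ (Fin n)) 1,
      (∫⁻ t in Ioi (0 : ℝ), ENNReal.ofReal (t ^ (n - 1)) *
        I (p, p + t • (ξ : EuclideanSpace ℝ (Fin n))))
        ∂(volume : Measure (EuclideanSpace ℝ (Fin n))).toSphere := by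
    intro p
    have hIp : Measurable fun z => I (p, p + z) :=
      hI.comp (measurable_const.prodMk (measurable_const_add p))
    rw [← lintegral_add_left_eq_self (fun q => I (p, q)) p]
    exact lintegral_eq_lintegral_toSphere hn hIp
  have h2 : ∀ ξ : Metric.sphere (0 : EuclideanSpace ℝ (Fin n)) 1,
      ∫⁻ p, (∫⁻ t in Ioi (0 : ℝ), ENNReal.ofReal (t ^ (n - 1)) *
        I (p, p + t • (ξ : EuclideanSpace ℝ (Fin n)))) =
      ∫⁻ y in hyperplane (ξ : EuclideanSpace ℝ (Fin n)), (∫⁻ s : ℝ,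
        (∫⁻ t in Ioi (0 : ℝ), ENNReal.ofReal (t ^ (n - 1)) *
          I (y + s • (ξ : EuclideanSpace ℝ (Fin n)),
            y + s • (ξ : EuclideanSpace ℝ (Fin n)) + t • (ξ : EuclideanSpace ℝ (Fin n)))))
        ∂μHE[n - 1] := by
    intro ξ
    exact lintegral_eq_lintegral_hyperplane ξ.2 (hF'.comp measurable_prodMk_right)
  -- Swapping puts the direction outermost; the base point is then split along that direction.
  rw [lintegral_prod _ hI.aemeasurable, lintegral_congr h1,
    lintegral_lintegral_swap hF'.aemeasurable, lintegral_congr h2]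

/-- The measure of the bad pairs is controlled by the energy. -/
theorem volume_badPairs_le (hn : 1 ≤ n) :
    ∃ C : ℝ≥0∞, C ≠ ∞ ∧ ∀ (Ω : Set (EuclideanSpace ℝ (Fin n)))
      (u g : EuclideanSpace ℝ (Fin n) → EuclideanSpace ℝ (Fin n)), Measurable g →
      (∀ᵐ z, z ∈ Ω → u z = g z) →
      (∀ᵐ ξ ∂(μHE[n - 1].restrict (unitSphere n)), ∀ᵐ y ∂(μHE[n - 1].restrict (hyperplane ξ)),
        IsBVLoc (sliceSet Ω ξ y) (slice u ξ y)) →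
      ∀ (x : EuclideanSpace ℝ (Fin n)) (R ε : ℝ), 0 < R → 0 < ε → ε ≤ 1 → Metric.ball x R ⊆ Ω →
      volume (badPairs g x R ε) ≤ ENNReal.ofReal ((2 * R) ^ (n + 1)) * (ENNReal.ofReal ε)⁻¹ *
        (C * muHat Ω u 1 (Metric.closedBall x R)) := by
  obtain ⟨C, hC, hle⟩ := map_toSphere_le (n := n)
  refine ⟨C, hC, fun Ω u g hg hug hBV x R ε hR hε hε1 hB => ?_⟩
  set K := ENNReal.ofReal ((2 * R) ^ (n + 1)) * (ENNReal.ofReal ε)⁻¹ with hK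
  have hKtop : K ≠ ∞ := ENNReal.mul_ne_top ENNReal.ofReal_ne_top (by simpa using hε)
  have hemb : MeasurableEmbedding
      (Subtype.val : Metric.sphere (0 : EuclideanSpace ℝ (Fin n)) 1 → _) :=
    MeasurableEmbedding.subtype_coe Metric.isClosed_sphere.measurableSet
  -- The slicing hypothesis holds for `H^{n-1}`-almost every direction but is used for the polar
  -- measure.
  have hac : ((volume : Measure (EuclideanSpace ℝ (Fin n))).toSphere).map Subtype.val ≪
      μHE[n - 1].restrict (unitSphere n) :=
    (Measure.absolutelyContinuous_of_le hle).trans Measure.smul_absolutelyContinuous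
  have hBV' := hemb.ae_map_iff.1 (hac.ae_le hBV)
  have hm := measurableSet_badPairs hg x R ε
  rw [← lintegral_indicator_one hm, Measure.volume_eq_prod,
    lintegral_prod_eq_lintegral_lines hn (measurable_one.indicator hm)]
  calc _ ≤ ∫⁻ ξ : Metric.sphere (0 : EuclideanSpace ℝ (Fin n)) 1,
        K * (∫⁻ y in hyperplane (ξ : EuclideanSpace ℝ (Fin n)),
          sliceEnergy Ω u ξ y (Metric.ball x R) ∂μHE[n - 1])
        ∂(volume : Measure (EuclideanSpace ℝ (Fin n))).toSphere := by
        refine lintegral_mono_ae ?_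
        filter_upwards [hBV'] with ξ hξ
        rw [← lintegral_const_mul' _ _ hKtop]
        refine lintegral_mono_ae ?_
        filter_upwards [hξ, ae_hyperplane_of_ae ξ.2 hug] with y hy1 hy2
        exact lintegral_badPairs_line_le hn hR hε hε1 hB ξ.2 hy1 hy2
    _ = K * ∫⁻ ξ, (∫⁻ y in hyperplane ξ,
          sliceEnergy Ω u ξ y (Metric.ball x R) ∂μHE[n - 1])
        ∂((volume : Measure (EuclideanSpace ℝ (Fin n))).toSphere).map Subtype.val := by
        rw [lintegral_const_mul' _ _ hKtop, hemb.lintegral_map]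
    _ ≤ K * (C * ∫⁻ ξ in unitSphere n, (∫⁻ y in hyperplane ξ,
          sliceEnergy Ω u ξ y (Metric.ball x R) ∂μHE[n - 1]) ∂μHE[n - 1]) := by
        gcongr
        rw [← smul_eq_mul C, ← lintegral_smul_measure]
        exact lintegral_mono' hle le_rfl
    _ ≤ _ := by
        gcongr
        exact lintegral_sliceEnergy_ball_le_muHat hR

/-! ### Points of vanishing density -/

/-- Preimages under a nondegenerate linear change of pairs have comparable measure. -/
lemma exists_volume_preimage_pair_le (n : ℕ) {a b c d : ℝ} (hdet : a * d - b * c ≠ 0) :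
    ∃ C : ℝ≥0∞, C ≠ ∞ ∧ ∀ (x : EuclideanSpace ℝ (Fin n))
      (s : Set (EuclideanSpace ℝ (Fin n) × EuclideanSpace ℝ (Fin n))),
      volume {p : EuclideanSpace ℝ (Fin n) × EuclideanSpace ℝ (Fin n) |
        (x + (a • p.1 + b • p.2), x + (c • p.1 + d • p.2)) ∈ s} ≤ C * volume s := by
  let f : EuclideanSpace ℝ (Fin n) × EuclideanSpace ℝ (Fin n) →ₗ[ℝ]
      EuclideanSpace ℝ (Fin n) × EuclideanSpace ℝ (Fin n) :=
    LinearMap.prod (a • LinearMap.fst ℝ _ _ + b • LinearMap.snd ℝ _ _)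
      (c • LinearMap.fst ℝ _ _ + d • LinearMap.snd ℝ _ _)
  have hinj : Function.Injective f := by
    rw [← LinearMap.ker_eq_bot, LinearMap.ker_eq_bot']
    rintro ⟨z, v⟩ h
    have h1 : a • z + b • v = 0 := congrArg Prod.fst h
    have h2 : c • z + d • v = 0 := congrArg Prod.snd h
    have h3 : (a * d - b * c) • z = d • (a • z + b • v) - b • (c • z + d • v) := by module
    have h4 : (a * d - b * c) • v = a • (c • z + d • v) - c • (a • z + b • v) := by module
    rw [h1, h2, smul_zero, smul_zero, sub_zero, smul_eq_zero] at h3 h4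
    rw [h3.resolve_left hdet, h4.resolve_left hdet]
    rfl
  have hf : LinearMap.det f ≠ 0 := (LinearEquiv.isUnit_det' (LinearEquiv.ofInjectiveEndo f hinj)).ne_zero
  refine ⟨ENNReal.ofReal |(LinearMap.det f)⁻¹|, ENNReal.ofReal_ne_top, fun x s => ?_⟩
  have h1 := Measure.addHaar_preimage_linearMap
    ((volume : Measure (EuclideanSpace ℝ (Fin n))).prod volume) hf
    ((fun p => (x, x) + p) ⁻¹' s)
  rw [measure_preimage_add] at h1
  exact h1.le

/-- The longitudinal differences along the six pairs of a parallelogram are linearly dependent. -/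
lemma inner_parallelogram {V : Type*} [NormedAddCommGroup V] [InnerProductSpace ℝ V]
    (p₁ p₂ q₁ q₂ a₁ a₂ b₁ b₂ : V) (h : p₁ - p₂ + q₁ - q₂ = 0) :
    inner ℝ (a₁ - a₂) (p₁ - p₂) = inner ℝ (a₁ - b₁) (p₁ - q₁) - inner ℝ (a₁ - b₂) (p₁ - q₂) -
      inner ℝ (a₂ - b₁) (p₂ - q₁) + inner ℝ (a₂ - b₂) (p₂ - q₂) - inner ℝ (b₁ - b₂) (q₁ - q₂) := by
  -- On the right, `a₁` and `a₂` are paired with `q₂ - q₁` and `q₁ - q₂`, that is `±(p₁ - p₂)`,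
  -- while the terms in `b₁` and `b₂` cancel.
  have hq : q₂ = p₁ - p₂ + q₁ := by rw [sub_eq_zero] at h; exact h.symm
  subst hq
  simp only [inner_sub_left, inner_sub_right, inner_add_right]
  ring

/-- Points `z` in an annulus for which the difference of `g` at the antipodal points `x ± z` has a
large longitudinal component. -/
def badAnnulus (g : EuclideanSpace ℝ (Fin n) → EuclideanSpace ℝ (Fin n))
    (x : EuclideanSpace ℝ (Fin n)) (ε r : ℝ) : Set (EuclideanSpace ℝ (Fin n)) :=
  {z | r / 2 ≤ ‖z‖ ∧ ‖z‖ < r ∧ 12 * ε * ‖z‖ < |inner ℝ (g (x + z) - g (x - z)) z|}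

lemma measurableSet_badAnnulus {g : EuclideanSpace ℝ (Fin n) → EuclideanSpace ℝ (Fin n)}
    (hg : Measurable g) (x : EuclideanSpace ℝ (Fin n)) (ε r : ℝ) :
    MeasurableSet (badAnnulus g x ε r) := by
  refine (measurableSet_le measurable_const measurable_norm).inter
    ((measurableSet_lt measurable_norm measurable_const).inter
    (measurableSet_lt (measurable_const.mul measurable_norm) ?_))
  have h1 : Measurable fun z : EuclideanSpace ℝ (Fin n) =>
      inner ℝ (g (x + z) - g (x - z)) z :=
    ((hg.comp (measurable_const_add x)).sub (hg.comp (measurable_id.const_sub x))).inner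
      measurable_id
  exact h1.abs

lemma notMem_badPairs {g : EuclideanSpace ℝ (Fin n) → EuclideanSpace ℝ (Fin n)}
    {x p q : EuclideanSpace ℝ (Fin n)} {R ε d : ℝ} (hε : 0 ≤ ε) (h : (p, q) ∉ badPairs g x R ε)
    (hp : p ∈ Metric.ball x R) (hq : q ∈ Metric.ball x R) (hd : ‖p - q‖ ≤ d) :
    |inner ℝ (g p - g q) (p - q)| ≤ ε * d := by
  by_contra! hcon
  exact h ⟨hp, hq, (mul_le_mul_of_nonneg_left hd hε).trans_lt hcon⟩

/-- Completing `x ± z` to parallelograms bounds the bad antipodal pairs by the bad pairs. -/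
lemma volume_badAnnulus_mul_le (n : ℕ) :
    ∃ M : ℝ≥0∞, M ≠ ∞ ∧ ∀ (g : EuclideanSpace ℝ (Fin n) → EuclideanSpace ℝ (Fin n))
      (x : EuclideanSpace ℝ (Fin n)) (ε r : ℝ), 0 < ε → 0 < r →
      volume (badAnnulus g x ε r) * volume (Metric.ball (0 : EuclideanSpace ℝ (Fin n)) r) ≤
        M * volume (badPairs g x (4 * r) ε) := by
  -- Each of the five pairs other than `x ± z` depends on `(z, v)` through one of these invertible
  -- coefficient matrices.
  obtain ⟨C₁, hC₁, h₁⟩ := exists_volume_preimage_pair_le n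
    (show (1 : ℝ) * 1 - 0 * 0 ≠ 0 by norm_num)
  obtain ⟨C₂, hC₂, h₂⟩ := exists_volume_preimage_pair_le n
    (show (1 : ℝ) * 1 - 0 * 2 ≠ 0 by norm_num)
  obtain ⟨C₃, hC₃, h₃⟩ := exists_volume_preimage_pair_le n
    (show (-1 : ℝ) * 1 - 0 * 0 ≠ 0 by norm_num)
  obtain ⟨C₄, hC₄, h₄⟩ := exists_volume_preimage_pair_le n
    (show (-1 : ℝ) * 1 - 0 * 2 ≠ 0 by norm_num)
  obtain ⟨C₅, hC₅, h₅⟩ := exists_volume_preimage_pair_le n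
    (show (0 : ℝ) * 1 - 1 * 2 ≠ 0 by norm_num)
  refine ⟨C₁ + C₂ + C₃ + C₄ + C₅, by simp [*], fun g x ε r hε hr => ?_⟩
  set s := badPairs g x (4 * r) ε with hs
  have hsub : badAnnulus g x ε r ×ˢ Metric.ball (0 : EuclideanSpace ℝ (Fin n)) r ⊆
      {p | (x + ((1 : ℝ) • p.1 + (0 : ℝ) • p.2), x + ((0 : ℝ) • p.1 + (1 : ℝ) • p.2)) ∈ s} ∪
      {p | (x + ((1 : ℝ) • p.1 + (0 : ℝ) • p.2), x + ((2 : ℝ) • p.1 + (1 : ℝ) • p.2)) ∈ s} ∪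
      {p | (x + ((-1 : ℝ) • p.1 + (0 : ℝ) • p.2), x + ((0 : ℝ) • p.1 + (1 : ℝ) • p.2)) ∈ s} ∪
      {p | (x + ((-1 : ℝ) • p.1 + (0 : ℝ) • p.2), x + ((2 : ℝ) • p.1 + (1 : ℝ) • p.2)) ∈ s} ∪
      {p | (x + ((0 : ℝ) • p.1 + (1 : ℝ) • p.2), x + ((2 : ℝ) • p.1 + (1 : ℝ) • p.2)) ∈ s} := by
    rintro ⟨z, v⟩ ⟨⟨hz1, hz2, hz3⟩, hv⟩
    by_contra hcon
    have hv' : ‖v‖ < r := by simpa using hv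
    simp only [mem_union, mem_ofPred_eq, not_or] at hcon
    obtain ⟨⟨⟨⟨n1, n2⟩, n3⟩, n4⟩, n5⟩ := hcon
    have e1 : x + ((1 : ℝ) • z + (0 : ℝ) • v) = x + z := by module
    have e2 : x + ((-1 : ℝ) • z + (0 : ℝ) • v) = x - z := by module
    have e3 : x + ((0 : ℝ) • z + (1 : ℝ) • v) = x + v := by module
    have e4 : x + ((2 : ℝ) • z + (1 : ℝ) • v) = x + ((2 : ℝ) • z + v) := by module
    rw [e1, e3] at n1
    rw [e1, e4] at n2
    rw [e2, e3] at n3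
    rw [e2, e4] at n4
    rw [e3, e4] at n5
    have m1 : x + z ∈ Metric.ball x (4 * r) := by
      simp only [Metric.mem_ball, dist_self_add_left]; linarith
    have m2 : x - z ∈ Metric.ball x (4 * r) := by
      rw [Metric.mem_ball, dist_eq_norm, sub_sub_cancel_left, norm_neg]; linarith
    have m3 : x + v ∈ Metric.ball x (4 * r) := by
      simp only [Metric.mem_ball, dist_self_add_left]; linarith
    have h2z : ‖(2 : ℝ) • z‖ = 2 * ‖z‖ := by simp [norm_smul]
    have h3z : ‖(3 : ℝ) • z‖ = 3 * ‖z‖ := by simp [norm_smul]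
    -- This is the farthest vertex, at distance below `3 r`, hence inside the ball of radius `4 r`.
    have m4 : x + ((2 : ℝ) • z + v) ∈ Metric.ball x (4 * r) := by
      simp only [Metric.mem_ball, dist_self_add_left]
      linarith [norm_add_le ((2 : ℝ) • z) v]
    have k1 := notMem_badPairs (d := 2 * r) hε.le n1 m1 m3 (by
      rw [add_sub_add_left_eq_sub]; linarith [norm_sub_le z v])
    have k2 := notMem_badPairs (d := 2 * r) hε.le n2 m1 m4 (by
      rw [show x + z - (x + ((2 : ℝ) • z + v)) = -(z + v) by module, norm_neg]
      linarith [norm_add_le z v])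
    have k3 := notMem_badPairs (d := 2 * r) hε.le n3 m2 m3 (by
      rw [show x - z - (x + v) = -(z + v) by module, norm_neg]
      linarith [norm_add_le z v])
    have k4 := notMem_badPairs (d := 4 * r) hε.le n4 m2 m4 (by
      rw [show x - z - (x + ((2 : ℝ) • z + v)) = -((3 : ℝ) • z + v) by module, norm_neg]
      linarith [norm_add_le ((3 : ℝ) • z) v])
    have k5 := notMem_badPairs (d := 2 * r) hε.le n5 m3 m4 (by
      rw [show x + v - (x + ((2 : ℝ) • z + v)) = -((2 : ℝ) • z) by module, norm_neg]
      linarith)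
    have key := inner_parallelogram (x + z) (x - z) (x + v) (x + ((2 : ℝ) • z + v))
      (g (x + z)) (g (x - z)) (g (x + v)) (g (x + ((2 : ℝ) • z + v))) (by module)
    rw [show x + z - (x - z) = (2 : ℝ) • z by module, real_inner_smul_right] at key
    rw [abs_le] at k1 k2 k3 k4 k5
    -- The five bounds add up to `12 ε r` for the product with `2 z`, so `6 ε r` with `z`; since `r
    -- ≤ 2 ‖z‖`, this is at most `12 ε ‖z‖`.
    have hεr : ε * r ≤ 2 * (ε * ‖z‖) := by nlinarith
    rw [lt_abs] at hz3
    rcases hz3 with h | h <;> linarith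
  rw [← Measure.prod_prod, ← Measure.volume_eq_prod]
  refine (measure_mono hsub).trans ?_
  rw [add_mul, add_mul, add_mul, add_mul]
  refine (measure_union_le _ _).trans (add_le_add ?_ (h₅ x s))
  refine (measure_union_le _ _).trans (add_le_add ?_ (h₄ x s))
  refine (measure_union_le _ _).trans (add_le_add ?_ (h₃ x s))
  exact (measure_union_le _ _).trans (add_le_add (h₁ x s) (h₂ x s))

/-- At a point of vanishing density the bad antipodal pairs have density zero. -/
theorem tendsto_volume_badAnnulus (hn : 1 ≤ n) {Ω : Set (EuclideanSpace ℝ (Fin n))}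
    (hΩ : IsOpen Ω) {u g : EuclideanSpace ℝ (Fin n) → EuclideanSpace ℝ (Fin n)}
    (hg : Measurable g) (hug : ∀ᵐ z, z ∈ Ω → u z = g z)
    (hBV : ∀ᵐ ξ ∂(μHE[n - 1].restrict (unitSphere n)),
      ∀ᵐ y ∂(μHE[n - 1].restrict (hyperplane ξ)), IsBVLoc (sliceSet Ω ξ y) (slice u ξ y))
    {x : EuclideanSpace ℝ (Fin n)} (hx : x ∈ Ω)
    (hdens : upperDensity (n - 1) (muHat Ω u 1) x = 0) {ε : ℝ} (hε : 0 < ε) (hε1 : ε ≤ 1) :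
    Tendsto (fun r : ℝ => volume (badAnnulus g x ε r) / ENNReal.ofReal (r ^ n)) (𝓝[>] 0) (𝓝 0) := by
  obtain ⟨C, hC, hpairs⟩ := volume_badPairs_le hn
  obtain ⟨M, hM, hann⟩ := volume_badAnnulus_mul_le n
  obtain ⟨R₀, hR₀, hball⟩ := Metric.isOpen_iff.1 hΩ x hx
  set α := volume (Metric.ball (0 : EuclideanSpace ℝ (Fin (n - 1))) 1) with hα
  have hα0 : α ≠ 0 := (Metric.measure_ball_pos _ _ one_pos).ne'
  have hαt : α ≠ ∞ := measure_ball_lt_top.ne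
  set ω := volume (Metric.ball (0 : EuclideanSpace ℝ (Fin n)) 1) with hω
  have hω0 : ω ≠ 0 := (Metric.measure_ball_pos _ _ one_pos).ne'
  have hωt : ω ≠ ∞ := measure_ball_lt_top.ne
  set θ : ℝ → ℝ≥0∞ := fun r =>
    muHat Ω u 1 (Metric.closedBall x r) / (α * ENNReal.ofReal (r ^ (n - 1))) with hθ
  have hθ0 : Tendsto θ (𝓝[>] 0) (𝓝 0) :=
    tendsto_of_le_liminf_of_limsup_le zero_le hdens.le
  have h4 : Tendsto (fun r : ℝ => 4 * r) (𝓝[>] 0) (𝓝[>] 0) := by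
    refine tendsto_nhdsWithin_iff.2 ⟨?_, ?_⟩
    · have : Tendsto (fun r : ℝ => 4 * r) (𝓝 0) (𝓝 (4 * 0)) := by
        exact (continuous_const.mul continuous_id).tendsto 0
      rw [mul_zero] at this
      exact this.mono_left nhdsWithin_le_nhds
    · filter_upwards [self_mem_nhdsWithin] with r hr
      exact mul_pos (show (0 : ℝ) < 4 by norm_num) hr
  set K : ℝ≥0∞ := M * (ENNReal.ofReal (8 ^ (n + 1) * 4 ^ (n - 1)) * (ENNReal.ofReal ε)⁻¹ *
    (C * α)) * ω⁻¹ with hK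
  have hKt : K ≠ ∞ := by
    refine ENNReal.mul_ne_top (ENNReal.mul_ne_top hM (ENNReal.mul_ne_top
      (ENNReal.mul_ne_top ENNReal.ofReal_ne_top ?_) (ENNReal.mul_ne_top hC hαt))) ?_
    · simpa using hε
    · simpa using hω0
  have hlim : Tendsto (fun r => K * θ (4 * r)) (𝓝[>] 0) (𝓝 0) := by
    have := ENNReal.Tendsto.const_mul (a := K) (hθ0.comp h4) (Or.inr hKt)
    rwa [mul_zero] at this
  refine tendsto_of_tendsto_of_tendsto_of_le_of_le' tendsto_const_nhds hlim
    (Eventually.of_forall fun _ => zero_le) ?_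
  filter_upwards [Ioo_mem_nhdsGT (show (0 : ℝ) < R₀ / 4 by linarith)] with r hr
  have hr0 : 0 < r := hr.1
  have hrn : 0 < r ^ n := pow_pos hr0 n
  have hsub : Metric.ball x (4 * r) ⊆ Ω :=
    (Metric.ball_subset_ball (by linarith [hr.2])).trans hball
  have h1 := hpairs Ω u g hg hug hBV x (4 * r) ε (by linarith) hε hε1 hsub
  have h2 := hann g x ε r hε hr0
  have hmu : muHat Ω u 1 (Metric.closedBall x (4 * r)) =
      θ (4 * r) * (α * ENNReal.ofReal ((4 * r) ^ (n - 1))) := by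
    simp only [hθ]
    rw [ENNReal.div_mul_cancel]
    · exact mul_ne_zero hα0 (by simp only [ne_eq, ENNReal.ofReal_eq_zero, not_le]; positivity)
    · exact ENNReal.mul_ne_top hαt ENNReal.ofReal_ne_top
  have hvol : volume (Metric.ball (0 : EuclideanSpace ℝ (Fin n)) r) = ENNReal.ofReal (r ^ n) * ω := by
    rw [Measure.addHaar_ball_of_pos _ _ hr0, finrank_euclideanSpace_fin]
  -- The exponents `n + 1` and `n - 1` add to `2 n`: one factor `r ^ n` cancels the volume of the
  -- ball of `v`, the other normalises the annulus.
  have hpow : ENNReal.ofReal ((2 * (4 * r)) ^ (n + 1)) * ENNReal.ofReal ((4 * r) ^ (n - 1)) =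
      ENNReal.ofReal (8 ^ (n + 1) * 4 ^ (n - 1)) * (ENNReal.ofReal (r ^ n) * ENNReal.ofReal (r ^ n)) := by
    rw [← ENNReal.ofReal_mul (by positivity), ← ENNReal.ofReal_mul (by positivity),
      ← ENNReal.ofReal_mul (by positivity)]
    congr 1
    obtain ⟨m, rfl⟩ := Nat.exists_eq_add_of_le' hn
    simp only [Nat.add_sub_cancel]
    ring
  have hr' : ENNReal.ofReal (r ^ n) ≠ 0 := by simpa using hrn
  rw [ENNReal.div_le_iff hr' ENNReal.ofReal_ne_top]
  have h3 : volume (badAnnulus g x ε r) * (ENNReal.ofReal (r ^ n) * ω) ≤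
      (K * θ (4 * r) * ENNReal.ofReal (r ^ n)) * (ENNReal.ofReal (r ^ n) * ω) := by
    rw [← hvol]
    refine h2.trans ((mul_le_mul_right h1 M).trans (le_of_eq ?_))
    rw [hmu, hvol, hK]
    calc _ = M * (ENNReal.ofReal ε)⁻¹ * C * α * θ (4 * r) *
          (ENNReal.ofReal ((2 * (4 * r)) ^ (n + 1)) * ENNReal.ofReal ((4 * r) ^ (n - 1))) := by ring
      _ = M * (ENNReal.ofReal ε)⁻¹ * C * α * θ (4 * r) *
          (ENNReal.ofReal (8 ^ (n + 1) * 4 ^ (n - 1)) *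
            (ENNReal.ofReal (r ^ n) * ENNReal.ofReal (r ^ n))) * (ω⁻¹ * ω) := by
          rw [hpow, ENNReal.inv_mul_cancel hω0 hωt, mul_one]
      _ = _ := by ring
  exact (ENNReal.mul_le_mul_iff_left (mul_ne_zero hr' hω0)
    (ENNReal.mul_ne_top ENNReal.ofReal_ne_top hωt)).1 h3

/-! ### From antipodal pairs to jumps along lines through `x` -/

/-- Points `t` of a dyadic interval at which the slices at `x ± t ξ` differ by more than `12 ε`. -/
def badTimes (g : EuclideanSpace ℝ (Fin n) → EuclideanSpace ℝ (Fin n))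
    (x : EuclideanSpace ℝ (Fin n)) (ε r : ℝ) (ξ : EuclideanSpace ℝ (Fin n)) : Set ℝ :=
  {t | t ∈ Ico (r / 2) r ∧ 12 * ε < |inner ℝ (g (x + t • ξ) - g (x - t • ξ)) ξ|}

/-- Measurability in the direction is needed to apply Fatou's lemma on the sphere. -/
lemma measurable_volume_badTimes {g : EuclideanSpace ℝ (Fin n) → EuclideanSpace ℝ (Fin n)}
    (hg : Measurable g) (x : EuclideanSpace ℝ (Fin n)) (ε r : ℝ) :
    Measurable fun ξ => volume (badTimes g x ε r ξ) := by
  have hm : MeasurableSet {q : EuclideanSpace ℝ (Fin n) × ℝ | q.2 ∈ Ico (r / 2) r ∧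
      12 * ε < |inner ℝ (g (x + q.2 • q.1) - g (x - q.2 • q.1)) q.1|} := by
    have h1 : Measurable fun q : EuclideanSpace ℝ (Fin n) × ℝ =>
        inner ℝ (g (x + q.2 • q.1) - g (x - q.2 • q.1)) q.1 :=
      ((hg.comp (by fun_prop)).sub (hg.comp (by fun_prop))).inner measurable_fst
    exact (measurable_snd measurableSet_Ico).inter (measurableSet_lt measurable_const h1.abs)
  exact measurable_measure_prodMk_left hm

/-- Polar coordinates for the bad antipodal pairs. -/
lemma lintegral_volume_badTimes_le (hn : 1 ≤ n)
    {g : EuclideanSpace ℝ (Fin n) → EuclideanSpace ℝ (Fin n)}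
    (hg : Measurable g) (x : EuclideanSpace ℝ (Fin n)) (ε : ℝ) {r : ℝ} (hr : 0 < r) :
    ∫⁻ ξ : Metric.sphere (0 : EuclideanSpace ℝ (Fin n)) 1,
      volume (badTimes g x ε r ξ) / ENNReal.ofReal r
      ∂(volume : Measure (EuclideanSpace ℝ (Fin n))).toSphere ≤
      ENNReal.ofReal (2 ^ (n - 1)) * (volume (badAnnulus g x ε r) / ENNReal.ofReal (r ^ n)) := by
  have hm := measurableSet_badAnnulus hg x ε r
  have hr' : ENNReal.ofReal r ≠ 0 := by simpa using hr
  have hrn : ENNReal.ofReal (r ^ n) ≠ 0 := by simpa using pow_pos hr n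
  -- The inner radius `r / 2` keeps the polar weight `t ^ (n - 1)` above `(r / 2) ^ (n - 1)`.
  have h1 : ∀ ξ : Metric.sphere (0 : EuclideanSpace ℝ (Fin n)) 1,
      ENNReal.ofReal ((r / 2) ^ (n - 1)) * volume (badTimes g x ε r ξ) ≤
      ∫⁻ t in Ioi (0 : ℝ), ENNReal.ofReal (t ^ (n - 1)) *
        (badAnnulus g x ε r).indicator 1 (t • (ξ : EuclideanSpace ℝ (Fin n))) := by
    intro ξ
    have hξ1 : ‖(ξ : EuclideanSpace ℝ (Fin n))‖ = 1 := by simp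
    have hsub : badTimes g x ε r ξ ⊆ Ioi (0 : ℝ) := fun t ht =>
      lt_of_lt_of_le (by positivity) ht.1.1
    calc _ = ∫⁻ _ in badTimes g x ε r ξ, ENNReal.ofReal ((r / 2) ^ (n - 1)) := by
          rw [setLIntegral_const]
      _ ≤ ∫⁻ t in badTimes g x ε r ξ, ENNReal.ofReal (t ^ (n - 1)) *
            (badAnnulus g x ε r).indicator 1 (t • (ξ : EuclideanSpace ℝ (Fin n))) := by
          have hmt : MeasurableSet (badTimes g x ε r ξ) := by
            have h1 : Measurable fun t : ℝ => inner ℝ (g (x + t • (ξ : EuclideanSpace ℝ (Fin n))) -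
                g (x - t • (ξ : EuclideanSpace ℝ (Fin n)))) (ξ : EuclideanSpace ℝ (Fin n)) :=
              ((hg.comp (by fun_prop)).sub (hg.comp (by fun_prop))).inner measurable_const
            exact measurableSet_Ico.inter (measurableSet_lt measurable_const h1.abs)
          refine setLIntegral_mono' hmt fun t ht => ?_
          have ht0 : 0 < t := hsub ht
          have hmem : t • (ξ : EuclideanSpace ℝ (Fin n)) ∈ badAnnulus g x ε r := by
            have hnorm : ‖t • (ξ : EuclideanSpace ℝ (Fin n))‖ = t := by
              rw [norm_smul, hξ1, mul_one, Real.norm_eq_abs, abs_of_pos ht0]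
            refine ⟨by rw [hnorm]; exact ht.1.1, by rw [hnorm]; exact ht.1.2, ?_⟩
            rw [hnorm, real_inner_smul_right, abs_mul, abs_of_pos ht0, mul_comm t]
            exact mul_lt_mul_of_pos_right ht.2 ht0
          rw [indicator_of_mem hmem, Pi.one_apply, mul_one]
          have := ht.1.1
          gcongr
      _ ≤ _ := lintegral_mono_set hsub
  have h2 : ENNReal.ofReal ((r / 2) ^ (n - 1)) *
      ∫⁻ ξ : Metric.sphere (0 : EuclideanSpace ℝ (Fin n)) 1, volume (badTimes g x ε r ξ)
      ∂(volume : Measure (EuclideanSpace ℝ (Fin n))).toSphere ≤ volume (badAnnulus g x ε r) := by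
    rw [← lintegral_const_mul' _ _ ENNReal.ofReal_ne_top, ← lintegral_indicator_one hm,
      lintegral_eq_lintegral_toSphere hn (measurable_one.indicator hm)]
    exact lintegral_mono h1
  simp only [div_eq_mul_inv]
  rw [lintegral_mul_const' _ _ (by simpa using hr)]
  set J := ∫⁻ ξ : Metric.sphere (0 : EuclideanSpace ℝ (Fin n)) 1, volume (badTimes g x ε r ξ)
      ∂(volume : Measure (EuclideanSpace ℝ (Fin n))).toSphere with hJ
  have hpow : ENNReal.ofReal (2 ^ (n - 1)) * ENNReal.ofReal ((r / 2) ^ (n - 1)) *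
      ENNReal.ofReal r = ENNReal.ofReal (r ^ n) := by
    rw [← ENNReal.ofReal_mul (by positivity), ← ENNReal.ofReal_mul (by positivity), ← mul_pow,
      mul_div_cancel₀ r two_ne_zero, ← pow_succ, Nat.sub_add_cancel hn]
  calc J * (ENNReal.ofReal r)⁻¹
      = J * (ENNReal.ofReal r)⁻¹ * (ENNReal.ofReal (r ^ n) * (ENNReal.ofReal (r ^ n))⁻¹) := by
        rw [ENNReal.mul_inv_cancel hrn ENNReal.ofReal_ne_top, mul_one]
    _ = ENNReal.ofReal (2 ^ (n - 1)) * ((ENNReal.ofReal ((r / 2) ^ (n - 1)) * J) *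
          (ENNReal.ofReal (r ^ n))⁻¹) * (ENNReal.ofReal r * (ENNReal.ofReal r)⁻¹) := by
        nth_rewrite 1 [← hpow]
        ring
    _ = ENNReal.ofReal (2 ^ (n - 1)) * ((ENNReal.ofReal ((r / 2) ^ (n - 1)) * J) *
          (ENNReal.ofReal (r ^ n))⁻¹) := by
        rw [ENNReal.mul_inv_cancel hr' ENNReal.ofReal_ne_top, mul_one]
    _ ≤ _ := by gcongr

/-- A jump of size larger than `12 ε` produces bad times at all small scales. -/
lemma not_liminf_badTimes_eq_zero {Ω : Set (EuclideanSpace ℝ (Fin n))}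
    (hΩ : IsOpen Ω) {u g : EuclideanSpace ℝ (Fin n) → EuclideanSpace ℝ (Fin n)}
    {x ξ : EuclideanSpace ℝ (Fin n)} (hx : x ∈ Ω) (hξ : ξ ∈ unitSphere n)
    (hug : ∀ᵐ t ∂(volume.restrict (Ioi (0 : ℝ))), (x + t • ξ ∈ Ω → u (x + t • ξ) = g (x + t • ξ)) ∧
      (x - t • ξ ∈ Ω → u (x - t • ξ) = g (x - t • ξ)))
    {a b ε : ℝ} (ha : IsLeftApproxLimit (sliceSet Ω ξ x) (slice u ξ x) 0 a)
    (hb : IsRightApproxLimit (sliceSet Ω ξ x) (slice u ξ x) 0 b) (hab : 12 * ε < |a - b|)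
    {r : ℕ → ℝ} (hr : Tendsto r atTop (𝓝[>] 0)) :
    liminf (fun k => volume (badTimes g x ε (r k) ξ) / ENNReal.ofReal (r k)) atTop ≠ 0 := by
  intro hlim
  have hξ1 : ‖ξ‖ = 1 := by simpa using hξ
  obtain ⟨R₀, hR₀, hball⟩ := Metric.isOpen_iff.1 hΩ x hx
  set δ := (|a - b| - 12 * ε) / 4 with hδ
  have hδ0 : 0 < δ := by rw [hδ]; linarith
  have h8 : (0 : ℝ≥0∞) < 1 / 8 := by simp
  have h4 : (0 : ℝ≥0∞) < 1 / 4 := by simp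
  -- A vanishing liminf gives smallness only at infinitely many scales, but the one-sided limits are
  -- good at all small scales, so a common scale exists. The thresholds 1/4, 1/8, 1/8 sum to 1/2,
  -- the relative length of `[ρ / 2, ρ)`.
  have hfreq : ∃ᶠ k in atTop, volume (badTimes g x ε (r k) ξ) / ENNReal.ofReal (r k) < 1 / 4 :=
    frequently_lt_of_liminf_lt (by isBoundedDefault) (by rw [hlim]; exact h4)
  have hev1 := ((ha δ hδ0).comp hr).eventually_lt_const h8
  have hev2 := ((hb δ hδ0).comp hr).eventually_lt_const h8
  have hev3 := hr.eventually (Ioo_mem_nhdsGT hR₀)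
  obtain ⟨k, ⟨⟨hk, hk1⟩, hk2⟩, hk3⟩ := (((hfreq.and_eventually hev1).and_eventually
    hev2).and_eventually hev3).exists
  simp only [Function.comp_apply, zero_sub, zero_add] at hk1 hk2
  set ρ := r k with hρ
  have hρ0 : 0 < ρ := hk3.1
  have hρ' : ENNReal.ofReal ρ ≠ 0 := by simpa using hρ0
  set L := {s | s ∈ Ioo (-ρ) 0 ∩ sliceSet Ω ξ x ∧ δ < |slice u ξ x s - a|} with hL
  set R := {s | s ∈ Ioo 0 ρ ∩ sliceSet Ω ξ x ∧ δ < |slice u ξ x s - b|} with hR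
  have hmemΩ : ∀ t : ℝ, |t| < ρ → x + t • ξ ∈ Ω := by
    intro t ht
    refine hball ?_
    rw [Metric.mem_ball, dist_self_add_left, norm_smul, hξ1, mul_one, Real.norm_eq_abs]
    exact ht.trans hk3.2
  have hsub : ∀ᵐ t : ℝ, t ∈ Ico (ρ / 2) ρ → t ∈ badTimes g x ε ρ ξ ∪ (R ∪ Neg.neg ⁻¹' L) := by
    filter_upwards [(ae_restrict_iff' measurableSet_Ioi).1 hug] with t ht htI
    have ht0 : 0 < t := lt_of_lt_of_le (by positivity) htI.1
    obtain ⟨hu1, hu2⟩ := ht ht0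
    have hm1 : x + t • ξ ∈ Ω := hmemΩ t (by rw [abs_of_pos ht0]; exact htI.2)
    have hm2 : x + (-t) • ξ ∈ Ω := hmemΩ (-t) (by rw [abs_neg, abs_of_pos ht0]; exact htI.2)
    have hneg : x + (-t) • ξ = x - t • ξ := by module
    by_contra hcon
    simp only [mem_union, not_or] at hcon
    obtain ⟨c1, c2, c3⟩ := hcon
    have d2 : |slice u ξ x t - b| ≤ δ := by
      by_contra! h
      exact c2 ⟨⟨⟨ht0, htI.2⟩, hm1⟩, h⟩
    have d3 : |slice u ξ x (-t) - a| ≤ δ := by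
      by_contra! h
      exact c3 ⟨⟨⟨by linarith [htI.2], by linarith⟩, hm2⟩, h⟩
    have d1 : |inner ℝ (g (x + t • ξ) - g (x - t • ξ)) ξ| ≤ 12 * ε := by
      by_contra! h
      exact c1 ⟨htI, h⟩
    rw [← hu1 hm1, ← hu2 (hneg ▸ hm2), inner_sub_left] at d1
    simp only [slice, hneg] at d2 d3
    have d4 : |a - b| = 4 * δ + 12 * ε := by rw [hδ]; ring
    rw [abs_le] at d1 d2 d3
    rcases abs_cases (a - b) with ⟨h, _⟩ | ⟨h, _⟩ <;> linarith
  have hvol : ENNReal.ofReal (ρ / 2) ≤ volume (badTimes g x ε ρ ξ) + (volume R + volume L) := by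
    have h1 : volume (Ico (ρ / 2) ρ) ≤ volume (badTimes g x ε ρ ξ ∪ (R ∪ Neg.neg ⁻¹' L)) :=
      measure_mono_ae hsub
    rw [Real.volume_Ico, sub_half] at h1
    refine h1.trans ((measure_union_le _ _).trans ?_)
    gcongr
    refine (measure_union_le _ _).trans ?_
    rw [Measure.measure_preimage_neg]
  have hdiv : (1 / 2 : ℝ≥0∞) ≤ volume (badTimes g x ε ρ ξ) / ENNReal.ofReal ρ +
      (volume R / ENNReal.ofReal ρ + volume L / ENNReal.ofReal ρ) := by
    rw [← ENNReal.add_div, ← ENNReal.add_div, ENNReal.le_div_iff_mul_le (Or.inl hρ')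
      (Or.inl ENNReal.ofReal_ne_top)]
    refine le_trans (le_of_eq ?_) hvol
    rw [ENNReal.ofReal_div_of_pos two_pos, ENNReal.ofReal_ofNat, one_div, mul_comm]
    rfl
  have hlt : volume (badTimes g x ε ρ ξ) / ENNReal.ofReal ρ +
      (volume R / ENNReal.ofReal ρ + volume L / ENNReal.ofReal ρ) <
      (1 / 4 + (1 / 8 + 1 / 8) : ℝ≥0∞) := ENNReal.add_lt_add hk (ENNReal.add_lt_add hk2 hk1)
  refine absurd (hdiv.trans_lt hlt) (not_lt.2 (le_of_eq ?_))
  rw [← ENNReal.toReal_eq_toReal_iff' (by finiteness) (by finiteness)]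
  rw [ENNReal.toReal_add (by finiteness) (by finiteness),
    ENNReal.toReal_add (by finiteness) (by finiteness)]
  norm_num

/-- At points of vanishing density, almost no direction sees a jump. -/
theorem hausdorff_jump_directions_eq_zero (hn : 1 ≤ n) {Ω : Set (EuclideanSpace ℝ (Fin n))}
    (hΩ : IsOpen Ω) {u : EuclideanSpace ℝ (Fin n) → EuclideanSpace ℝ (Fin n)}
    (hu : MemGBVE Ω u) {x : EuclideanSpace ℝ (Fin n)} (hx : x ∈ Ω)
    (hdens : upperDensity (n - 1) (muHat Ω u 1) x = 0) :
    μHE[n - 1] {ξ | ξ ∈ unitSphere n ∧ (0 : ℝ) ∈ jumpSet (sliceSet Ω ξ x) (slice u ξ x)} = 0 := by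
  obtain ⟨hmeas, hBV, -⟩ := hu
  set g := hmeas.mk u with hgdef
  have hg : Measurable g := hmeas.measurable_mk
  have hug : ∀ᵐ z, z ∈ Ω → u z = g z :=
    (ae_restrict_iff' hΩ.measurableSet).1 hmeas.ae_eq_mk
  set ε : ℕ → ℝ := fun m => 1 / ((m : ℝ) + 1) with hεdef
  have hε0 : ∀ m, 0 < ε m := fun m => by positivity
  have hε1 : ∀ m, ε m ≤ 1 := fun m => by
    simp only [hεdef]
    rw [div_le_one (by positivity)]
    have : (0 : ℝ) ≤ m := Nat.cast_nonneg m
    linarith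
  have hεlim : Tendsto ε atTop (𝓝 0) := tendsto_one_div_add_atTop_nhds_zero_nat
  have hεlim' : Tendsto ε atTop (𝓝[>] 0) :=
    tendsto_nhdsWithin_iff.2 ⟨hεlim, Eventually.of_forall hε0⟩
  have hae1 : ∀ᵐ ξ : Metric.sphere (0 : EuclideanSpace ℝ (Fin n)) 1
      ∂(volume : Measure (EuclideanSpace ℝ (Fin n))).toSphere, ∀ m : ℕ,
      liminf (fun k => volume (badTimes g x (ε m) (ε k) ξ) / ENNReal.ofReal (ε k)) atTop = 0 := by
    rw [ae_all_iff]
    intro m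
    have hmk : ∀ k, Measurable fun ξ : Metric.sphere (0 : EuclideanSpace ℝ (Fin n)) 1 =>
        volume (badTimes g x (ε m) (ε k) ξ) / ENNReal.ofReal (ε k) := fun k =>
      ((measurable_volume_badTimes hg x (ε m) (ε k)).comp measurable_subtype_coe).div_const _
    have hlim := (tendsto_volume_badAnnulus hn hΩ hg hug hBV hx hdens (hε0 m) (hε1 m)).comp hεlim'
    have hlim2 := ENNReal.Tendsto.const_mul (a := ENNReal.ofReal (2 ^ (n - 1))) hlim
      (Or.inr ENNReal.ofReal_ne_top)
    rw [mul_zero] at hlim2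
    have hint : ∫⁻ ξ : Metric.sphere (0 : EuclideanSpace ℝ (Fin n)) 1,
        liminf (fun k => volume (badTimes g x (ε m) (ε k) ξ) / ENNReal.ofReal (ε k)) atTop
        ∂(volume : Measure (EuclideanSpace ℝ (Fin n))).toSphere = 0 := by
      -- Fatou's lemma: convergence of the integrals to zero forces the liminf to vanish almost
      -- everywhere.
      refine le_antisymm ((lintegral_liminf_le hmk).trans ?_) zero_le
      rw [← hlim2.liminf_eq]
      exact liminf_le_liminf (Eventually.of_forall fun k =>
        lintegral_volume_badTimes_le hn hg x (ε m) (hε0 k))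
    exact (lintegral_eq_zero_iff (Measurable.liminf hmk)).1 hint
  have hae2 := ae_toSphere_of_ae hn
    (P := fun z => (x + z ∈ Ω → u (x + z) = g (x + z)) ∧ (x - z ∈ Ω → u (x - z) = g (x - z))) (by
      filter_upwards [(measurePreserving_add_left volume x).quasiMeasurePreserving.ae hug,
        (Measure.measurePreserving_sub_left volume x).quasiMeasurePreserving.ae hug] with z h1 h2
      exact ⟨h1, h2⟩)
  have hnull := hausdorff_null_of_toSphere_null hn (ae_iff.1 (hae1.and hae2))
  refine measure_mono_null ?_ hnull
  rintro ξ ⟨hξ, -, a, b, ha, hb, hab⟩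
  refine ⟨⟨ξ, hξ⟩, fun hcon => ?_, rfl⟩
  have hpos : 0 < |a - b| / 12 := div_pos (abs_pos.2 (sub_ne_zero.2 hab)) (by norm_num)
  -- Any jump, however small, exceeds `12 ε m` for some `m`; the null set of directions was chosen
  -- for all `m` at once.
  obtain ⟨m, hm⟩ := (hεlim.eventually_lt_const hpos).exists
  exact not_liminf_badTimes_eq_zero hΩ hx hξ hcon.2 ha hb (by linarith) hεlim' (hcon.1 m)

/-- No ball of positive radius fits in the empty set, so only the empty family competes. -/
lemma muHat_empty (Ω : Set (EuclideanSpace ℝ (Fin n)))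
    (u : EuclideanSpace ℝ (Fin n) → EuclideanSpace ℝ (Fin n)) (p : ℝ) : muHat Ω u p ∅ = 0 := by
  refine le_antisymm ?_ zero_le
  refine iInf_le_of_le ∅ (iInf_le_of_le isOpen_empty (iInf_le_of_le subset_rfl
    (iInf_le_of_le (empty_subset _) ?_)))
  refine iSup_le fun 𝓑 => iSup_le fun h𝓑 => ?_
  have hemp : 𝓑 = ∅ := by
    refine Finset.eq_empty_of_forall_notMem fun B hB => ?_
    obtain ⟨c, r, hr, rfl⟩ := h𝓑.1 B hB
    exact h𝓑.2.1 _ hB (Metric.mem_ball_self hr)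
  simp [hemp]

end GBVE

end

theorem proposition3p12 {n : ℕ} (hn : 1 ≤ n)
    (Ω : Set (EuclideanSpace ℝ (Fin n))) (hΩ : IsOpen Ω)
    (u : EuclideanSpace ℝ (Fin n) → EuclideanSpace ℝ (Fin n)) (hu : GBVE.MemGBVE Ω u) :
    GBVE.muHat Ω u 1 {x | x ∈ Ω ∧
      ¬ (GBVE.upperDensity (n - 1) (GBVE.muHat Ω u 1) x = 0 →
        μHE[n - 1] {ξ | ξ ∈ GBVE.unitSphere n ∧
          (0 : ℝ) ∈ GBVE.jumpSet (GBVE.sliceSet Ω ξ x) (GBVE.slice u ξ x)} = 0)} = 0 := by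
  -- The implication holds at every point of `Ω`, so the exceptional set is empty.
  convert GBVE.muHat_empty Ω u 1
  refine eq_empty_of_forall_notMem fun x hx => hx.2 fun hdens => ?_
  exact GBVE.hausdorff_jump_directions_eq_zero hn hΩ hu hx.1 hdens
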